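/- Let $G$ be a finite simple connected graph with $n$ vertices and $m$ edges, and let $T$ be a spanning tree of $G$ with root $r$. A vertex $v$ is an ancestor of $u$ (and $u$ a descendant of $v$) if $v$ lies on the path of $T$ from $r$ to $u$; every vertex is an ancestor and a descendant of itself, and "proper" excludes equality. The tree $T$ is *normal* if the ends of every edge of $G$ are comparable, i.e. one of them is an ancestor of the other. A *back-edge* $(x,y)$ is an edge of $G$ that is not in $T$, where $x$ is the descendant of $y$. For a vertex $v$ let $L(v)$ be the set of proper ancestors of $v$ that are adjacent in $G$ to a descendant of $v$; $lwpt_k(v)$ is the $k$-th lowest element of $L(v)$ (the one with exactly $k-1$ proper ancestors in $L(v)$) if $|L(v)|\ge k$, and $v$ otherwise. A numbering of the vertices by $1,\dots,n$ (vertices are identified with their numbers) is *compatible with $T$* if for every vertex $j$ the descendants of $j$ form exactly the interval $[j, j+ND(j)-1]$, where $ND(j)$ is their number, and if for all siblings $j<k$ either $lwpt_1(j)>lwpt_1(k)$, or $lwpt_1(j)=lwpt_1(k)$ and $lwpt_2(j)\le lwpt_2(k)$. The *left child* of a vertex is its largest child, and $w$ is a *leftmost descendant* of $v$ if it is reached from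 $v$ by going to the left child zero or more times. $T[a,b]$ is a *leftmost path* if $b$ is a leftmost descendant of a child $a'$ of $a$ (in particular $a<b$); a leftmost path $T[a,b]$ is *stable* if every back-edge $(x,y)$ with $a'\le x<b$ satisfies $y\ge a$. If $T[a,b]$ is a leftmost path, let $stab(a,b)$ be the largest ancestor $\alpha$ of $a$ such that $T[\alpha,b]$ is a stable leftmost path, and $0$ if there is none; if $T[a,b]$ is not a leftmost path (in particular if $a\ge b$), let $stab(a,b)=0$. **Proposition.** There is an algorithm which, given a finite graph $G$ equipped with a normal spanning tree $T$ and a numbering of its vertices that is compatible with $T$, after a precomputation in time $O(n+m)$, can compute every value $stab(a,b)$, $a,b\in V(G)$, in constant time. Precisely, on a word RAM with unit-cost arithmetic (addition, truncated subtraction, multiplication, division, remainder, comparison) and array access on $w$-bit words, there are a precomputation program, a query program and a constant $c$ such that the following holds for every such $(G,T)$ with compatible numbering and every word length $w$ with $(n+m+1)^c\le 2^w$. Given $n$, $m$, the parent of every vertex in $T$ and the list of the edges of $G$ in an arbitrary order, the precomputation halts after at most $c\,(n+m)$ steps; and afterwards, for every finite sequence of pairs of vertices $(a,b)$, put one after the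 other, the query program answers each of them with $stab(a,b)$ in at most $c$ steps. -/

import Mathlib

universe u

namespace StabQuery

/-! ### Rooted spanning trees -/

section Trees

variable {V : Type u}

/-- `v` is an ancestor of `u` in the tree `T` rooted at `r`: it lies on the path of `T` from `r`
to `u`. -/
def IsAncestor (T : SimpleGraph V) (r v u : V) : Prop :=
  ∃ p : T.Walk r u, p.IsPath ∧ v ∈ p.support

/-- `v` is a proper ancestor of `u`. -/
def IsProperAncestor (T : SimpleGraph V) (r v u : V) : Prop :=
  IsAncestor T r v u ∧ v ≠ u

/-- The set of (not necessarily proper) descendants of `v`. -/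
def desc (T : SimpleGraph V) (r v : V) : Set V :=
  {u | IsAncestor T r v u}

/-- `u` is the parent of `v`, that is, `v` is a child of `u`. -/
def IsParent (T : SimpleGraph V) (r u v : V) : Prop :=
  T.Adj u v ∧ IsAncestor T r u v

/-- `T`, rooted at `r`, is a normal spanning tree of `G`. -/
structure IsNormalSpanningTree (G T : SimpleGraph V) (r : V) : Prop where
  le : T ≤ G
  isTree : T.IsTree
  comparable : ∀ x y, G.Adj x y → IsAncestor T r x y ∨ IsAncestor T r y x

/-- `(x, y)` is a back-edge: an edge of `G` outside `T`, where `x` is a descendant of `y`. -/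
def IsBackEdge (G T : SimpleGraph V) (r x y : V) : Prop :=
  G.Adj x y ∧ ¬ T.Adj x y ∧ IsAncestor T r y x

/-- The set `L(v)` of proper ancestors of `v` that are adjacent in `G` to a descendant of `v`. -/
def lowSet (G T : SimpleGraph V) (r v : V) : Set V :=
  {y | IsProperAncestor T r y v ∧ ∃ d ∈ desc T r v, G.Adj d y}

open Classical in
/-- The `k`-th lowpoint of `v` (for `k ≥ 1`): the `k`-th lowest element of `L(v)`, that is, the
element of `L(v)` with exactly `k - 1` proper ancestors in `L(v)`, if `L(v)` has at least `k`
elements, and `v` otherwise. (`L(v)` is a chain of ancestors of `v`.) -/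
noncomputable def lwpt (G T : SimpleGraph V) (r : V) (k : ℕ) (v : V) : V :=
  if h : ∃ x ∈ lowSet G T r v,
      {y | y ∈ lowSet G T r v ∧ IsProperAncestor T r y x}.ncard + 1 = k
  then h.choose else v

/-- The order `≤'` on pairs of integers: `(x, y) ≤' (x', y')` if and only if
`(-x, y) ≤ (-x', y')` lexicographically. -/
def pairLE (p q : ℤ × ℤ) : Prop :=
  toLex (-p.1, p.2) ≤ toLex (-q.1, q.2)

/-- The numbering `num` of the vertices of `G` is compatible with the tree `T` rooted at `r`. -/
structure IsCompatible [Fintype V] (G T : SimpleGraph V) (r : V) (num : V → ℕ) : Prop where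
  bijOn : Set.BijOn num Set.univ (Set.Icc 1 (Fintype.card V))
  interval : ∀ j : V,
    num '' desc T r j = Set.Icc (num j) (num j + (desc T r j).ncard - 1)
  siblings : ∀ p j k : V, IsParent T r p j → IsParent T r p k → num j < num k →
    pairLE (num (lwpt G T r 1 j), num (lwpt G T r 2 j))
      (num (lwpt G T r 1 k), num (lwpt G T r 2 k))

/-! ### Leftmost paths and stability -/

/-- `c` is the left child of `v`, its child with the largest number. -/
def IsLeftChild (T : SimpleGraph V) (r : V) (num : V → ℕ) (v c : V) : Prop :=
  IsParent T r v c ∧ ∀ d, IsParent T r v d → num d ≤ num c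

/-- `w` is a leftmost descendant of `v`: it is reached from `v` by going from a vertex to its left
child zero or more times. -/
def IsLeftmostDesc (T : SimpleGraph V) (r : V) (num : V → ℕ) (v w : V) : Prop :=
  Relation.ReflTransGen (IsLeftChild T r num) v w

/-- `T[a, b]` is a leftmost path, with lower end `a`: `b` is a leftmost descendant of some child
`a'` of `a`. -/
def IsLeftmostPath (T : SimpleGraph V) (r : V) (num : V → ℕ) (a b : V) : Prop :=
  ∃ a', IsParent T r a a' ∧ IsLeftmostDesc T r num a' b

/-- `T[a, b]` is a stable leftmost path: if `a'` is the child of `a` of which `b` is a leftmost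
descendant, every back-edge `(x, y)` with `a' ≤ x < b` satisfies `y ≥ a`. -/
def IsStable (G T : SimpleGraph V) (r : V) (num : V → ℕ) (a b : V) : Prop :=
  ∃ a', IsParent T r a a' ∧ IsLeftmostDesc T r num a' b ∧
    ∀ x y, IsBackEdge G T r x y → num a' ≤ num x → num x < num b → num a ≤ num y

open Classical in
/-- If `T[a, b]` is a leftmost path, `stab(a, b)` is (the number of) the largest ancestor `α` of
`a` such that `T[α, b]` is stable, and `0` if there is none (the supremum of the empty set of
natural numbers is `0`). If `T[a, b]` is not a leftmost path, it is `0`. -/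
noncomputable def stab (G T : SimpleGraph V) (r : V) (num : V → ℕ) (a b : V) : ℕ :=
  if IsLeftmostPath T r num a b then
    sSup {k | ∃ α, IsAncestor T r α a ∧ IsStable G T r num α b ∧ num α = k}
  else 0

end Trees

/-! ### A word RAM

A program has finitely many scalar variables (registers) and finitely many one-dimensional arrays,
all of them holding `w`-bit words, and indexed by natural numbers in the program text. Arithmetic is
modulo `2 ^ w` (subtraction is truncated at `0`). Every elementary operation costs one step. -/

/-- The contents of the variables and of the arrays. -/
@[ext] structure State where
  var : ℕ → ℕ
  arr : ℕ → ℕ → ℕ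

/-- Overwrite a variable. -/
def State.setVar (s : State) (x v : ℕ) : State :=
  { s with var := Function.update s.var x v }

/-- Overwrite one entry of an array. -/
def State.setArr (s : State) (k i v : ℕ) : State :=
  { s with arr := Function.update s.arr k (Function.update (s.arr k) i v) }

/-- The binary operations of the machine. -/
inductive Op where
  | add | sub | mul | div | mod | lt | eq

/-- The result of a binary operation on `w`-bit words; comparisons return `1` or `0`. -/
def Op.eval (w : ℕ) : Op → ℕ → ℕ → ℕ
  | .add, a, b => (a + b) % 2 ^ w
  | .sub, a, b => a - b
  | .mul, a, b => (a * b) % 2 ^ w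
  | .div, a, b => a / b
  | .mod, a, b => a % b
  | .lt, a, b => if a < b then 1 else 0
  | .eq, a, b => if a = b then 1 else 0

/-- Expressions: integer constants, variables, array entries, binary operations. -/
inductive Expr where
  | lit (k : ℕ)
  | var (x : ℕ)
  | get (k : ℕ) (i : Expr)
  | bin (o : Op) (e₁ e₂ : Expr)

/-- The value of an expression. -/
def Expr.eval (w : ℕ) (s : State) : Expr → ℕ
  | .lit k => k % 2 ^ w
  | .var x => s.var x
  | .get k i => s.arr k (i.eval w s)
  | .bin o e₁ e₂ => o.eval w (e₁.eval w s) (e₂.eval w s)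

/-- The number of elementary operations that evaluate an expression. -/
def Expr.cost : Expr → ℕ
  | .lit _ => 1
  | .var _ => 1
  | .get _ i => i.cost + 1
  | .bin _ e₁ e₂ => e₁.cost + e₂.cost + 1

/-- Programs: no operation, assignment to a variable, assignment `k[i] := e` to an array entry,
sequential composition, conditional, and a `while` loop. -/
inductive Cmd where
  | nop
  | assign (x : ℕ) (e : Expr)
  | write (k : ℕ) (i e : Expr)
  | seq (c₁ c₂ : Cmd)
  | branch (e : Expr) (c₁ c₂ : Cmd)
  | loop (e : Expr) (c : Cmd)

/-- `Exec w c s t s'`: started in the state `s`, the program `c` halts in the state `s'` after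
exactly `t` steps. A test succeeds if its value is not `0`. -/
inductive Exec (w : ℕ) : Cmd → State → ℕ → State → Prop where
  | nop (s : State) : Exec w .nop s 1 s
  | assign (x : ℕ) (e : Expr) (s : State) :
      Exec w (.assign x e) s (e.cost + 1) (s.setVar x (e.eval w s))
  | write (k : ℕ) (i e : Expr) (s : State) :
      Exec w (.write k i e) s (i.cost + e.cost + 1) (s.setArr k (i.eval w s) (e.eval w s))
  | seq {c₁ c₂ : Cmd} {s₁ s₂ s₃ : State} {t₁ t₂ : ℕ} :
      Exec w c₁ s₁ t₁ s₂ → Exec w c₂ s₂ t₂ s₃ → Exec w (.seq c₁ c₂) s₁ (t₁ + t₂) s₃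
  | branch_true {e : Expr} {c₁ c₂ : Cmd} {s s' : State} {t : ℕ} :
      e.eval w s ≠ 0 → Exec w c₁ s t s' → Exec w (.branch e c₁ c₂) s (e.cost + 1 + t) s'
  | branch_false {e : Expr} {c₁ c₂ : Cmd} {s s' : State} {t : ℕ} :
      e.eval w s = 0 → Exec w c₂ s t s' → Exec w (.branch e c₁ c₂) s (e.cost + 1 + t) s'
  | loop_true {e : Expr} {c : Cmd} {s₁ s₂ s₃ : State} {t₁ t₂ : ℕ} :
      e.eval w s₁ ≠ 0 → Exec w c s₁ t₁ s₂ → Exec w (.loop e c) s₂ t₂ s₃ →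
      Exec w (.loop e c) s₁ (e.cost + 1 + t₁ + t₂) s₃
  | loop_false {e : Expr} {c : Cmd} {s : State} :
      e.eval w s = 0 → Exec w (.loop e c) s (e.cost + 1) s

/-- The machine is deterministic: the running time and the final state are unique. -/
theorem Exec.det {w : ℕ} {c : Cmd} {s s₁ s₂ : State} {t₁ t₂ : ℕ}
    (h₁ : Exec w c s t₁ s₁) (h₂ : Exec w c s t₂ s₂) : t₁ = t₂ ∧ s₁ = s₂ := by
  induction h₁ generalizing t₂ s₂ with
  | nop => cases h₂; exact ⟨rfl, rfl⟩
  | assign => cases h₂; exact ⟨rfl, rfl⟩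
  | write => cases h₂; exact ⟨rfl, rfl⟩
  | seq _ _ ih₁ ih₂ =>
    cases h₂ with
    | seq k₁ k₂ =>
      obtain ⟨rfl, rfl⟩ := ih₁ k₁
      obtain ⟨rfl, rfl⟩ := ih₂ k₂
      exact ⟨rfl, rfl⟩
  | branch_true he _ ih =>
    cases h₂ with
    | branch_true _ k => obtain ⟨rfl, rfl⟩ := ih k; exact ⟨rfl, rfl⟩
    | branch_false he' _ => exact absurd he' he
  | branch_false he _ ih =>
    cases h₂ with
    | branch_true he' _ => exact absurd he he'
    | branch_false _ k => obtain ⟨rfl, rfl⟩ := ih k; exact ⟨rfl, rfl⟩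
  | loop_true he _ _ ih₁ ih₂ =>
    cases h₂ with
    | loop_true _ k₁ k₂ =>
      obtain ⟨rfl, rfl⟩ := ih₁ k₁
      obtain ⟨rfl, rfl⟩ := ih₂ k₂
      exact ⟨rfl, rfl⟩
    | loop_false he' => exact absurd he' he
  | loop_false he =>
    cases h₂ with
    | loop_true he' _ _ => exact absurd he he'
    | loop_false _ => exact ⟨rfl, rfl⟩

/-! ### Input and queries -/

section Input

variable {V : Type u}

/-- `e` lists the edges of `G`, each one exactly once, in any order and with the two ends of an
edge in any order. In particular `m` is the number of edges of `G`. -/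
def IsEdgeList (G : SimpleGraph V) {m : ℕ} (e : Fin m → V × V) : Prop :=
  Set.BijOn (fun i => s((e i).1, (e i).2)) Set.univ G.edgeSet

open Classical in
/-- The number of the parent of the vertex number `i`, and `0` if `i` is the number of the root or
not the number of a vertex. -/
noncomputable def parentNum (T : SimpleGraph V) (r : V) (num : V → ℕ) (i : ℕ) : ℕ :=
  if h : ∃ u v, num v = i ∧ IsParent T r u v then num h.choose else 0

/-- The input of the precomputation, where vertices are represented by their numbers: variable `0`
holds the number `n` of vertices and variable `1` the number `m` of edges, array `0` holds the
parent of every vertex in `T` (at the indices `1` to `n`), and the arrays `1` and `2` hold the two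
ends of every edge of `G` (at the indices `0` to `m - 1`). Everything else is `0`. -/
noncomputable def inputState [Fintype V] (T : SimpleGraph V) (r : V) (num : V → ℕ) {m : ℕ}
    (e : Fin m → V × V) : State where
  var := fun x => if x = 0 then Fintype.card V else if x = 1 then m else 0
  arr := fun k i =>
    if k = 0 then parentNum T r num i
    else if h : i < m then
      if k = 1 then num (e ⟨i, h⟩).1 else if k = 2 then num (e ⟨i, h⟩).2 else 0
    else 0

/-- `Answers w query c num f qs s`: when the queries of the list `qs` are put one after the other,
the first one in the state `s` and each of the others in the state that the previous one has left
behind, the program `query` answers each of them in at most `c` steps. The query `(a, b)` is put by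
writing the numbers of `a` and `b` into the variables `0` and `1`; the answer, which has to be
`f a b`, is returned in the variable `0`. -/
def Answers (w : ℕ) (query : Cmd) (c : ℕ) (num : V → ℕ) (f : V → V → ℕ) :
    List (V × V) → State → Prop
  | [], _ => True
  | (a, b) :: qs, s =>
    ∃ (t : ℕ) (s' : State), Exec w query ((s.setVar 0 (num a)).setVar 1 (num b)) t s' ∧
      t ≤ c ∧ s'.var 0 = f a b ∧ Answers w query c num f qs s'

end Input

end StabQuery

open StabQuery

/-!
Let the vertices be identified with their numbers. By the interval condition the numbering is a
preorder, so the descendants of `v` are `v, …, last v`, and `w` is a leftmost descendant of `v` if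
and only if `v ≤ w` and `last v = last w` (`PreTree`, `IsCompatible.isLeftmostDesc_iff`). The order
of siblings by lowpoints is not needed.

Walk down a maximal leftmost path and represent the path from `p w` to `b` by the child `w` of its
first vertex `p w`. The set of those `w` that give stable paths to `b` changes like a stack: when `b`
moves to its left child, all `w` disappear for which `p w` is greater than the least target of an
edge that starts in `b` or in the subtree of another child of `b`, and these are the largest elements
of the set; then the new vertex is pushed. So the stack of `b` is `b`, `nextValid b`,
`nextValid (nextValid b)`, … (`Candidate.pop`, `Candidate.done`), and a potential argument shows that
popping takes linear time altogether (`PreTree.potential_step`).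

The value of `stab` for `a = p c` and `b`, with `c < b`, is the parent of the largest element `≤ c`
of the stack of `b`, and this is the minimum of `p (nextValid u)` over the path vertices `u` in
`(c, b]`. It is the minimum over all numbers in `(c, b]` too, if vertices with `nextValid u = 0` get
a number that shows that there is no stable path at all, but does not matter for the paths of which
their own path branches off: the least target of an edge from the subtree of the head of their path
(`PreTree.rangeMin_spec`).

This leaves range minimum queries on an array, in constant time after linear preprocessing. The
array is divided into blocks of logarithmic length. Inside a block the positions of the suffix minima
form a stack, stored as a binary number at each position; a table of lowest bits finds the minimum
(`IsMask.isRangeMin`). Between blocks the minima over `2 ^ k` consecutive blocks are stored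
(`IsSparseTable`).

The programs are verified with the loop rule `Runs.init_loop`, in which a decreasing measure bounds
the number of rounds. All numbers that occur are less than `100 * (n + m + 1)`, so nothing overflows.
-/

namespace StabQuery

/-! ### Preorder-numbered trees -/

/-- A rooted tree on `1, …, n` in preorder numbering: `p v` is the parent of `v` (`0` for the
root `1`), and the descendants of `v` are `v, …, last v`. -/
structure PreTree (n : ℕ) (p last : ℕ → ℕ) : Prop where
  le_last : ∀ v, 1 ≤ v → v ≤ n → v ≤ last v
  last_le : ∀ v, 1 ≤ v → v ≤ n → last v ≤ n
  par_lt : ∀ v, 1 ≤ v → v ≤ n → p v < v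
  par_pos : ∀ v, 2 ≤ v → v ≤ n → 1 ≤ p v
  par_zero : p 0 = 0
  anc : ∀ u v, 1 ≤ u → u ≤ n → 1 ≤ v → v ≤ n →
    (u < v ∧ v ≤ last u ↔ u ≤ p v ∧ p v ≤ last u)

/-- The left (that is, largest) child of `v`, and `0` if `v` is a leaf or `v = 0`. -/
def leftChild (n : ℕ) (p : ℕ → ℕ) (v : ℕ) : ℕ :=
  Nat.findGreatest (fun c => 1 ≤ v ∧ p c = v) n

/-- For `b` on the leftmost path that starts in `u`: the path from the parent of `u` to `b` is
stable with respect to the set `E` of edges, written as pairs (upper number, lower number). -/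
def Valid (E : ℕ → ℕ → Prop) (p : ℕ → ℕ) (u b : ℕ) : Prop :=
  ∀ x y, E x y → u ≤ x → x < b → p u ≤ y

open Classical in
/-- The largest vertex `w < u` on the maximal leftmost path through `u` for which
the path from the parent of `w` to `u` is stable, and `0` if there is none. On leftmost paths,
`last` is constant, which is how membership in the same path is expressed. -/
noncomputable def nextValid (n : ℕ) (p last : ℕ → ℕ) (E : ℕ → ℕ → Prop) (u : ℕ) : ℕ :=
  Nat.findGreatest
    (fun w => 1 ≤ w ∧ w < u ∧ u ≤ n ∧ last w = last u ∧ Valid E p w u) u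

theorem Valid.refl (E : ℕ → ℕ → Prop) (p : ℕ → ℕ) (u : ℕ) : Valid E p u u := by
  intro x y _ h1 h2; omega

theorem Valid.trans {E : ℕ → ℕ → Prop} {p : ℕ → ℕ} {w u b : ℕ} (h1 : Valid E p w u)
    (h2 : Valid E p u b) (hp : p w ≤ p u) : Valid E p w b := by
  intro x y hE hx hb
  rcases lt_or_ge x u with hu | hu
  · exact h1 x y hE hx hu
  · exact hp.trans (h2 x y hE hu hb)

theorem Valid.mono {E : ℕ → ℕ → Prop} {p : ℕ → ℕ} {w u b : ℕ} (h1 : Valid E p w b)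
    (hub : u ≤ b) : Valid E p w u :=
  fun x y hE hx hu => h1 x y hE hx (hu.trans_le hub)

/-- `m` is the minimum of `H` on `[i, j]`. -/
def IsRangeMin (H : ℕ → ℕ) (i j m : ℕ) : Prop :=
  ∀ α, α ≤ m ↔ ∀ x, i ≤ x → x ≤ j → α ≤ H x

namespace PreTree

variable {n : ℕ} {p last : ℕ → ℕ} (T : PreTree n p last)
include T

/-- Descendants of descendants are descendants. -/
theorem last_mono {u v : ℕ} (hu : 1 ≤ u) (huv : u ≤ v) (hv : v ≤ last u) (hun : u ≤ n) :
    last v ≤ last u := by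
  have hvn : v ≤ n := hv.trans (T.last_le u hu hun)
  have key : ∀ x, v ≤ x → x ≤ last v → x ≤ last u := by
    intro x
    induction x using Nat.strong_induction_on with
    | _ x ih =>
      intro h1 h2
      rcases h1.eq_or_lt with rfl | h1
      · exact hv
      have hxn : x ≤ n := h2.trans (T.last_le v (by omega) hvn)
      obtain ⟨h3, h4⟩ := (T.anc v x (by omega) hvn (by omega) hxn).1 ⟨h1, h2⟩
      have h5 := ih (p x) (T.par_lt x (by omega) hxn) h3 h4
      exact ((T.anc u x hu hun (by omega) hxn).2 ⟨by omega, h5⟩).2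
  exact key _ (T.le_last v (by omega) hvn) le_rfl

theorem exists_child {u x : ℕ} (hu : 1 ≤ u) (hun : u ≤ n) (hux : u < x) (hx : x ≤ last u) :
    ∃ c, u < c ∧ c ≤ x ∧ x ≤ last c ∧ p c = u := by
  induction x using Nat.strong_induction_on with
  | _ x ih =>
    have hxn : x ≤ n := hx.trans (T.last_le u hu hun)
    obtain ⟨h3, h4⟩ := (T.anc u x hu hun (by omega) hxn).1 ⟨hux, hx⟩
    have hpx := T.par_lt x (by omega) hxn
    rcases h3.eq_or_lt with h3 | h3
    · exact ⟨x, hux, le_rfl, T.le_last x (by omega) hxn, h3.symm⟩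
    · obtain ⟨c, hc1, hc2, hc3, hc4⟩ := ih (p x) hpx h3 h4
      have := (T.anc c x (by omega) (by omega) (by omega) hxn).2 ⟨hc2, hc3⟩
      exact ⟨c, hc1, by omega, this.2, hc4⟩

omit T in
theorem leftChild_le (v : ℕ) : leftChild n p v ≤ n := Nat.findGreatest_le n

omit T in
theorem par_leftChild {v : ℕ} (h : leftChild n p v ≠ 0) : 1 ≤ v ∧ p (leftChild n p v) = v :=
  Nat.findGreatest_of_ne_zero (P := fun c => 1 ≤ v ∧ p c = v) rfl h

omit T in
theorem le_leftChild {v c : ℕ} (hv : 1 ≤ v) (hc : c ≤ n) (hp : p c = v) :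
    c ≤ leftChild n p v :=
  Nat.le_findGreatest (P := fun c => 1 ≤ v ∧ p c = v) hc ⟨hv, hp⟩

theorem lt_leftChild {v : ℕ} (h : leftChild n p v ≠ 0) : v < leftChild n p v := by
  have h1 := par_leftChild h
  have := T.par_lt (leftChild n p v) (by omega) (leftChild_le v)
  omega

theorem le_last_par {c : ℕ} (h2 : 1 ≤ p c) (hc1 : 1 ≤ c) (hc : c ≤ n) : c ≤ last (p c) := by
  have := T.par_lt c hc1 hc
  exact ((T.anc (p c) c h2 (by omega) hc1 hc).2
    ⟨le_rfl, T.le_last _ h2 (by omega)⟩).2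

theorem last_lt_leftChild {v c : ℕ} (hv : 1 ≤ v) (hc1 : 1 ≤ c) (hc : c ≤ n) (hp : p c = v)
    (hne : c ≠ leftChild n p v) : last c < leftChild n p v := by
  have h1 := le_leftChild hv hc hp
  have h2 := par_leftChild (n := n) (p := p) (v := v) (by omega)
  by_contra hcon
  have := (T.anc c (leftChild n p v) hc1 hc (by omega) (leftChild_le v)).1 ⟨by omega, by omega⟩
  have := T.par_lt c hc1 hc
  omega

theorem last_leftChild {v : ℕ} (h : leftChild n p v ≠ 0) :
    last (leftChild n p v) = last v := by
  obtain ⟨hv, hp⟩ := par_leftChild h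
  have hlt := T.lt_leftChild h
  have hln := leftChild_le (n := n) (p := p) v
  have hle := T.le_last_par (c := leftChild n p v) (by omega) (by omega) hln
  rw [hp] at hle
  refine le_antisymm (T.last_mono hv hlt.le hle (by omega)) ?_
  obtain ⟨c, hc1, hc2, hc3, hc4⟩ := T.exists_child (x := last v) hv (by omega) (by omega) le_rfl
  have hcn : c ≤ n := hc2.trans (T.last_le v hv (by omega))
  by_cases hcl : c = leftChild n p v
  · rwa [← hcl]
  · have := T.last_lt_leftChild hv (by omega) hcn hc4 hcl
    omega

/-- A vertex below `u` with the same last descendant is reached through the left child of `u`. -/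
theorem leftChild_of_lt {u v : ℕ} (hu : 1 ≤ u) (huv : u < v) (hv : v ≤ n)
    (hl : last u = last v) : leftChild n p u ≠ 0 ∧ leftChild n p u ≤ v := by
  have hvl := T.le_last v (by omega) hv
  obtain ⟨c, hc1, hc2, hc3, hc4⟩ := T.exists_child hu (by omega) huv (hl ▸ hvl)
  have h2 := T.last_mono (by omega) hc2 hc3 (by omega)
  have h1 := le_leftChild (n := n) hu (by omega) hc4
  have h3 := T.last_leftChild (v := u) (by omega)
  by_cases hcl : c = leftChild n p u
  · omega
  · have := T.last_lt_leftChild hu (by omega) (by omega) hc4 hcl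
    have := T.le_last (leftChild n p u) (by omega) (leftChild_le u)
    omega

theorem par_of_lt {u v : ℕ} (hu : 1 ≤ u) (huv : u < v) (hv : v ≤ n)
    (hl : last u = last v) : u ≤ p v ∧ last (p v) = last v := by
  have hvl := T.le_last v (by omega) hv
  have h := (T.anc u v hu (by omega) (by omega) hv).1 ⟨huv, by omega⟩
  have h1 := T.last_mono hu h.1 h.2 (by omega)
  have h2 := T.par_lt v (by omega) hv
  have h3 := T.last_mono (by omega) h2.le (T.le_last_par (c := v) (by omega) (by omega) hv)
    (by omega)
  omega

theorem leftChild_par_iff {c : ℕ} (hc : 2 ≤ c) (hcn : c ≤ n) :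
    leftChild n p (p c) = c ↔ last (p c) = last c := by
  have h1 := T.par_pos c hc hcn
  have h2 := T.par_lt c (by omega) hcn
  constructor
  · intro h
    have := T.last_leftChild (v := p c) (by omega)
    rw [h] at this
    exact this.symm
  · intro h
    have h3 := T.leftChild_of_lt h1 h2 hcn h
    have h4 := le_leftChild (n := n) h1 hcn rfl
    omega

theorem par_mono {w u : ℕ} (hw : 1 ≤ w) (hwu : w ≤ u) (hu : u ≤ n) (hl : last w = last u) :
    p w ≤ p u := by
  rcases hwu.eq_or_lt with rfl | h
  · rfl
  · have := (T.par_of_lt hw h hu hl).1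
    have := T.par_lt w hw (by omega)
    omega

/-! ### Stable leftmost paths in a preorder-numbered tree -/

section Edges

variable {E : ℕ → ℕ → Prop}

omit T in
theorem nextValid_spec {u : ℕ} (h : nextValid n p last E u ≠ 0) :
    nextValid n p last E u < u ∧ u ≤ n ∧ last (nextValid n p last E u) = last u ∧
      Valid E p (nextValid n p last E u) u := by
  classical
  have := Nat.findGreatest_of_ne_zero
    (P := fun w => 1 ≤ w ∧ w < u ∧ u ≤ n ∧ last w = last u ∧ Valid E p w u) rfl h
  exact this.2

omit T in
theorem le_nextValid {w u : ℕ} (hw : 1 ≤ w) (hwu : w < u) (hu : u ≤ n) (hl : last w = last u)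
    (hv : Valid E p w u) : w ≤ nextValid n p last E u := by
  classical
  exact Nat.le_findGreatest
    (P := fun w => 1 ≤ w ∧ w < u ∧ u ≤ n ∧ last w = last u ∧ Valid E p w u) hwu.le
    ⟨hw, hwu, hu, hl, hv⟩

omit T in
theorem nextValid_lt {u : ℕ} (hu : u ≠ 0) : nextValid n p last E u < u := by
  by_cases h : nextValid n p last E u = 0
  · omega
  · exact (nextValid_spec h).1

/-- The stack of the head of a leftmost path is empty. -/
theorem nextValid_eq_zero {u : ℕ} (h : u = 1 ∨ n < u ∨ leftChild n p (p u) ≠ u) :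
    nextValid n p last E u = 0 := by
  by_contra h0
  obtain ⟨h1, h2, h3, _⟩ := nextValid_spec h0
  rcases h with h | h | h
  · omega
  · omega
  · exact h ((T.leftChild_par_iff (by omega) h2).2 (T.par_of_lt (by omega) h1 h2 h3).2)

/-- What is known about the candidate `u` while the stack of the leftmost path of `v` is being
popped: `u` is on the stack, and no larger stack element survives in the stack of the left child
of `v`. -/
def Candidate (n : ℕ) (p last : ℕ → ℕ) (E : ℕ → ℕ → Prop) (v u : ℕ) : Prop :=
  (u = 0 ∨ 1 ≤ u ∧ u ≤ v ∧ last u = last v ∧ Valid E p u v) ∧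
    (leftChild n p v ≠ 0 → nextValid n p last E (leftChild n p v) ≤ u)

theorem candidate_self {v : ℕ} (hv : 1 ≤ v) : Candidate n p last E v v := by
  refine ⟨Or.inr ⟨hv, le_rfl, rfl, Valid.refl E p v⟩, fun h => ?_⟩
  by_cases h0 : nextValid n p last E (leftChild n p v) = 0
  · omega
  obtain ⟨h1, h2, h3, _⟩ := nextValid_spec h0
  have := (T.par_of_lt (by omega) h1 h2 h3).1
  rwa [(par_leftChild h).2] at this

/-- `A` is the function of the least targets: `A v` is the least end of an edge from `v` or from
the subtree of a child of `v` other than the left one. -/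
def IsOwnLow (n : ℕ) (p : ℕ → ℕ) (E : ℕ → ℕ → Prop) (A : ℕ → ℕ) : Prop :=
  ∀ v, leftChild n p v ≠ 0 →
    ∀ α, α ≤ A v ↔ ∀ x y, E x y → v ≤ x → x < leftChild n p v → α ≤ y

/-- If an edge that starts between `v` and its left child has a target less than the parent of the candidate
`u`, then the element after `u` on the stack is the next candidate. -/
theorem Candidate.pop {A : ℕ → ℕ} (hA : IsOwnLow n p E A) {v u : ℕ}
    (h : Candidate n p last E v u) (hlt : A v < p u) :
    Candidate n p last E v (nextValid n p last E u) := by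
  obtain ⟨h1, h2⟩ := h
  have hu0 : u ≠ 0 := by rintro rfl; rw [T.par_zero] at hlt; omega
  obtain ⟨hu1, huv, hul, huV⟩ := h1.resolve_left hu0
  constructor
  · by_cases h0 : nextValid n p last E u = 0
    · exact Or.inl h0
    · obtain ⟨k1, k2, k3, k4⟩ := nextValid_spec h0
      exact Or.inr ⟨by omega, by omega, by omega,
        k4.trans huV (T.par_mono (by omega) k1.le k2 k3)⟩
  · intro hl
    have hw := h2 hl
    by_cases h0 : nextValid n p last E (leftChild n p v) = 0
    · omega
    obtain ⟨k1, k2, k3, k4⟩ := nextValid_spec h0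
    have hvl := T.lt_leftChild hl
    have hll := T.last_leftChild hl
    rcases hw.eq_or_lt with he | hw
    · rw [he] at k4
      have := (hA v hl (p u)).2 fun x y hE hx hxl => k4 x y hE (huv.trans hx) hxl
      omega
    · exact le_nextValid (by omega) hw (by omega) (by omega) (k4.mono (by omega))

/-- The first candidate that survives is the top of the stack of the left child of `v`. -/
theorem Candidate.done {A : ℕ → ℕ} (hA : IsOwnLow n p E A) {v u : ℕ}
    (h : Candidate n p last E v u) (hle : p u ≤ A v) (hl : leftChild n p v ≠ 0) :
    nextValid n p last E (leftChild n p v) = u := by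
  obtain ⟨h1, h2⟩ := h
  refine le_antisymm (h2 hl) ?_
  rcases h1 with rfl | ⟨hu1, huv, hul, huV⟩
  · exact Nat.zero_le _
  have hvl := T.lt_leftChild hl
  have hll := T.last_leftChild hl
  refine le_nextValid hu1 (by omega) (leftChild_le v) (by omega) ?_
  intro x y hE hux hxl
  rcases lt_or_ge x v with hxv | hxv
  · exact huV x y hE hux hxv
  · exact (hA v hl (p u)).1 hle x y hE hxv hxl

/-- `low v` is the least target of an edge from the subtree of `v`. -/
def IsLow (n : ℕ) (last : ℕ → ℕ) (E : ℕ → ℕ → Prop) (low : ℕ → ℕ) : Prop :=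
  ∀ v, 1 ≤ v → v ≤ n → ∀ α, α ≤ low v ↔ ∀ x y, E x y → v ≤ x → x ≤ last v → α ≤ y

/-- `hd v` is the top vertex of the maximal leftmost path through `v`. -/
def IsHead (n : ℕ) (last : ℕ → ℕ) (hd : ℕ → ℕ) : Prop :=
  ∀ v, 1 ≤ v → v ≤ n → 1 ≤ hd v ∧ hd v ≤ v ∧ last (hd v) = last v ∧
    ∀ u, 1 ≤ u → u ≤ v → last u = last v → hd v ≤ u

omit T in
theorem head_eq_iff {hd : ℕ → ℕ} (hh : IsHead n last hd) {a b : ℕ} (ha : 1 ≤ a) (hab : a ≤ b)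
    (hb : b ≤ n) : hd a = hd b ↔ last a = last b := by
  obtain ⟨a1, a2, a3, a4⟩ := hh a ha (by omega)
  obtain ⟨b1, b2, b3, b4⟩ := hh b (by omega) hb
  constructor
  · intro h
    rw [← a3, h, b3]
  · intro h
    have h1 := b4 (hd a) a1 (by omega) (by omega)
    have h2 := a4 (hd b) b1 (by omega) (by omega)
    omega

/-- `H x` is the parent of `nextValid x` if there is such a vertex. Otherwise it is the least target of
an edge from the subtree of the head of the leftmost path of `x`; unless `x` is the head, this is
less than the parent of the head. -/
def IsValue (n : ℕ) (p last : ℕ → ℕ) (E : ℕ → ℕ → Prop) (low hd H : ℕ → ℕ) : Prop :=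
  ∀ x, 1 ≤ x → x ≤ n → H x =
    if nextValid n p last E x = 0 then low (hd x) else p (nextValid n p last E x)

/-- A vertex `x` strictly between consecutive vertices of a leftmost path has a value too large to
matter for that path. -/
theorem le_value_of_between {low hd H : ℕ → ℕ} (hlow : IsLow n last E low)
    (hh : IsHead n last hd) (hH : IsValue n p last E low hd H) {v x α : ℕ}
    (hv : 1 ≤ v) (hx : v < x) (hxl : x < leftChild n p v) (hαv : α ≤ v)
    (hα : ∀ x y, E x y → v ≤ x → x < leftChild n p v → α ≤ y) : α ≤ H x := by
  have hl : leftChild n p v ≠ 0 := by omega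
  have hln := leftChild_le (n := n) (p := p) v
  have hll := T.last_leftChild hl
  have hlast := T.le_last (leftChild n p v) (by omega) hln
  obtain ⟨c, hc1, hc2, hc3, hc4⟩ := T.exists_child hv (by omega) hx (by omega)
  have hcl := T.last_lt_leftChild hv (by omega) (by omega) hc4 (by omega)
  have hxc := T.last_mono (by omega) hc2 hc3 (by omega)
  rw [hH x (by omega) (by omega)]
  obtain ⟨h1, h2, h3, -⟩ := hh x (by omega) (by omega)
  -- the vertices above `x` on its leftmost path lie in `(v, leftChild v)`
  have habove : ∀ u, 1 ≤ u → u ≤ x → last u = last x → v < u := by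
    intro u hu hux hul
    by_contra hcon
    have := T.last_mono hu (Nat.le_of_not_lt hcon)
      (by have := T.le_last x (by omega) (by omega); omega) (by omega)
    omega
  split_ifs with h0
  · refine (hlow _ h1 (by omega) α).2 fun y z hE hy hyl => hα y z hE ?_ (by omega)
    have := habove _ h1 h2 h3
    omega
  · obtain ⟨k1, k2, k3, k4⟩ := nextValid_spec h0
    have h5 := habove _ (by omega) k1.le k3
    have := T.le_last x (by omega) (by omega)
    have := (T.anc v _ hv (by omega) (by omega) (by omega)).1 ⟨h5, by omega⟩
    omega

/-- Every vertex between two vertices of a leftmost path lies on the path or strictly between two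
consecutive vertices of it. -/
theorem on_path_or_between {a b x : ℕ} (ha : 1 ≤ a) (hax : a ≤ x) (hxb : x ≤ b) (hb : b ≤ n)
    (hl : last a = last b) : last x = last b ∨
      ∃ v, a ≤ v ∧ v < x ∧ x < leftChild n p v ∧ leftChild n p v ≤ b := by
  by_cases hx : last x = last b
  · exact Or.inl hx
  right
  -- take the last vertex `v` of the path with `v ≤ x`
  classical
  let v := Nat.findGreatest (fun v => a ≤ v ∧ last v = last b) x
  obtain ⟨hv1, hv2⟩ : a ≤ v ∧ last v = last b :=
    Nat.findGreatest_spec (P := fun v => a ≤ v ∧ last v = last b) hax ⟨le_rfl, hl⟩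
  have hvx : v ≤ x := Nat.findGreatest_le x
  have hvne : v ≠ x := by intro h; rw [h] at hv2; exact hx hv2
  have hxne : x ≠ b := by rintro rfl; exact hx rfl
  have h1 := T.leftChild_of_lt (by omega) (by omega : v < b) hb hv2
  have h2 := T.last_leftChild h1.1
  have h3 := T.lt_leftChild h1.1
  refine ⟨v, hv1, by omega, ?_, h1.2⟩
  by_contra hcon
  have : leftChild n p v ≤ v :=
    Nat.le_findGreatest (P := fun v => a ≤ v ∧ last v = last b) (by omega) ⟨by omega, by omega⟩
  omega

/-- Stability of leftmost paths as a range minimum: if `a` is strictly above `b` on a leftmost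
path, the valid candidates at or above `a` are governed by the minimum of the values of the
vertices in `(a, b]`. -/
theorem rangeMin_spec {low hd H : ℕ → ℕ} (hlow : IsLow n last E low)
    (hh : IsHead n last hd) (hH : IsValue n p last E low hd H) {a b m : ℕ}
    (ha : 1 ≤ a) (hab : a < b) (hb : b ≤ n) (hl : last a = last b)
    (hm : IsRangeMin H (a + 1) b m) :
    (∀ w, 1 ≤ w → w ≤ a → last w = last b → Valid E p w b → p w ≤ m ∧ p (hd b) ≤ m) ∧
    (p (hd b) ≤ m → ∃ w, 1 ≤ w ∧ w ≤ a ∧ last w = last b ∧ Valid E p w b ∧ m = p w) := by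
  obtain ⟨hd1, hd2, hd3, hd4⟩ := hh b (by omega) hb
  have first : ∀ w, 1 ≤ w → w ≤ a → last w = last b → Valid E p w b → p w ≤ m := by
    intro w hw hwa hwl hwV
    refine (hm _).2 fun x hx hxb => ?_
    rcases T.on_path_or_between ha (by omega : a ≤ x) hxb hb hl with hxl | ⟨v, hv1, hv2, hv3, hv4⟩
    · have h1 := le_nextValid hw (by omega) (hxb.trans hb) (hwl.trans hxl.symm) (hwV.mono hxb)
      have h0 : nextValid n p last E x ≠ 0 := by omega
      rw [hH x (by omega) (by omega), if_neg h0]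
      obtain ⟨k1, k2, k3, k4⟩ := nextValid_spec h0
      exact T.par_mono hw h1 (by omega) (by omega)
    · have := T.par_lt w hw (by omega)
      exact T.le_value_of_between hlow hh hH (by omega) hv2 hv3 (by omega)
        fun x y hE hx hxl => hwV x y hE (by omega) (by omega)
  refine ⟨fun w hw hwa hwl hwV => ⟨first w hw hwa hwl hwV, ?_⟩, fun hle => ?_⟩
  · exact (T.par_mono hd1 (hd4 w hw (by omega) hwl) (by omega) (by omega)).trans
      (first w hw hwa hwl hwV)
  -- follow `nextValid` from `b` until `a` is passed
  have walk : ∀ u, a < u → u ≤ b → last u = last b → Valid E p u b →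
      ∃ u', a < u' ∧ u' ≤ b ∧ last u' = last b ∧ nextValid n p last E u' ≤ a ∧
        (nextValid n p last E u' ≠ 0 → Valid E p (nextValid n p last E u') b) := by
    intro u
    induction u using Nat.strong_induction_on with
    | _ u ih =>
      intro h1 h2 h3 h4
      have hV : nextValid n p last E u ≠ 0 → Valid E p (nextValid n p last E u) b := by
        intro h0
        obtain ⟨k1, k2, k3, k4⟩ := nextValid_spec h0
        exact k4.trans h4 (T.par_mono (by omega) k1.le k2 k3)
      rcases le_or_gt (nextValid n p last E u) a with h5 | h5
      · exact ⟨u, h1, h2, h3, h5, hV⟩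
      · obtain ⟨k1, k2, k3, k4⟩ := nextValid_spec (n := n) (p := p) (last := last) (E := E)
          (u := u) (by omega)
        exact ih _ k1 h5 (by omega) (by omega) (hV (by omega))
  obtain ⟨u, h1, h2, h3, h4, h5⟩ := walk b hab le_rfl rfl (Valid.refl E p b)
  have hmu : m ≤ H u := (hm m).1 le_rfl u (by omega) h2
  rw [hH u (by omega) (by omega)] at hmu
  obtain ⟨u1, u2, u3, u4⟩ := hh u (by omega) (by omega)
  split_ifs at hmu with h0
  · -- the head is not valid, so an edge from its subtree has a target less than its parent
    exfalso
    have hhd : hd u = hd b := (head_eq_iff hh (by omega) h2 hb).2 h3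
    have hda : hd b ≤ a := hd4 a ha hab.le hl
    have hul := T.le_last u (by omega) (by omega)
    have : 1 ≤ nextValid n p last E u := by
      refine le_trans hd1 (le_nextValid hd1 (by omega) (by omega) (by omega) ?_)
      intro x y hE hx hxu
      refine (hlow (hd b) hd1 (by omega) (p (hd b))).1 ?_ x y hE hx (by omega)
      rw [← hhd] at hle ⊢
      omega
    omega
  · obtain ⟨k1, k2, k3, k4⟩ := nextValid_spec h0
    refine ⟨_, by omega, h4, by omega, h5 h0, le_antisymm hmu ?_⟩
    exact first _ (by omega) h4 (by omega) (h5 h0)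

end Edges

end PreTree

/-! ### From spanning trees to preorder-numbered trees -/

section Graph

variable {V : Type u} {G T : SimpleGraph V} {r : V}

theorem isAncestor_iff_of_isPath (hT : T.IsTree) {u v : V} {q : T.Walk v r} (hq : q.IsPath) :
    IsAncestor T r u v ↔ u ∈ q.support := by
  constructor
  · rintro ⟨p, hp, hu⟩
    have := (hT.isAcyclic.subsingleton_path r v).elim ⟨p, hp⟩ ⟨q.reverse, hq.reverse⟩
    have h2 : p = q.reverse := congrArg Subtype.val this
    rw [h2] at hu
    simpa using hu
  · intro hu
    exact ⟨q.reverse, hq.reverse, by simpa using hu⟩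

theorem exists_isPath_to_root (hT : T.IsTree) (v : V) : ∃ q : T.Walk v r, q.IsPath := by
  classical
  obtain ⟨q⟩ := hT.connected.preconnected v r
  exact ⟨q.toPath, q.toPath.2⟩

theorem isAncestor_refl (hT : T.IsTree) (v : V) : IsAncestor T r v v := by
  obtain ⟨q, hq⟩ := exists_isPath_to_root (r := r) hT v
  exact (isAncestor_iff_of_isPath hT hq).2 q.start_mem_support

theorem root_isAncestor (hT : T.IsTree) (v : V) : IsAncestor T r r v := by
  obtain ⟨q, hq⟩ := exists_isPath_to_root (r := r) hT v
  exact (isAncestor_iff_of_isPath hT hq).2 q.end_mem_support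

theorem exists_isParent (hT : T.IsTree) {v : V} (hv : v ≠ r) : ∃ u, IsParent T r u v := by
  obtain ⟨q, hq⟩ := exists_isPath_to_root (r := r) hT v
  cases q with
  | nil => exact absurd rfl hv
  | @cons _ w _ hadj q =>
    exact ⟨w, hadj.symm, (isAncestor_iff_of_isPath hT hq).2 (by simp)⟩

theorem not_isParent_root (hT : T.IsTree) {u : V} : ¬ IsParent T r u r := by
  rintro ⟨hadj, hanc⟩
  have := (isAncestor_iff_of_isPath hT (q := SimpleGraph.Walk.nil) (by simp)).1 hanc
  simp only [SimpleGraph.Walk.support_nil, List.mem_singleton] at this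
  exact hadj.ne this

/-- The path of the tree to `v` is the path to the parent of `v`, extended by `v`. -/
theorem IsParent.isAncestor_iff (hT : T.IsTree) {u v : V} (h : IsParent T r u v) (x : V) :
    IsAncestor T r x v ↔ x = v ∨ IsAncestor T r x u := by
  classical
  obtain ⟨hadj, hanc⟩ := h
  obtain ⟨q, hq⟩ := exists_isPath_to_root (r := r) hT v
  have hq' := hq
  rw [isAncestor_iff_of_isPath hT hq'] at hanc ⊢
  cases q with
  | nil =>
    simp only [SimpleGraph.Walk.support_nil, List.mem_singleton] at hanc
    exact absurd hanc hadj.ne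
  | @cons _ w _ hvw q =>
    rw [SimpleGraph.Walk.cons_isPath_iff] at hq
    have hu : u ∈ q.support := by
      simpa [hadj.ne] using hanc
    have hpath : (SimpleGraph.Walk.cons hadj.symm (q.dropUntil u hu)).IsPath := by
      rw [SimpleGraph.Walk.cons_isPath_iff]
      exact ⟨hq.1.dropUntil hu, fun hv => hq.2 (q.support_dropUntil_subset_support hu hv)⟩
    have heq : SimpleGraph.Walk.cons hadj.symm (q.dropUntil u hu) = SimpleGraph.Walk.cons hvw q :=
      congrArg Subtype.val
        ((hT.isAcyclic.subsingleton_path v r).elim ⟨_, hpath⟩ ⟨_, hq'⟩)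
    have huw : u = w := by
      have := congrArg (fun z => z.getVert 1) heq
      simpa using this
    subst huw
    rw [isAncestor_iff_of_isPath hT hq.1]
    simp

end Graph

section Numbering

variable {V : Type u} [Fintype V] {G T : SimpleGraph V} {r : V} {num : V → ℕ}

open Classical in
/-- The number of the last descendant of the vertex number `i`. -/
noncomputable def lastNum (T : SimpleGraph V) (r : V) (num : V → ℕ) (i : ℕ) : ℕ :=
  if h : ∃ v, num v = i then i + (desc T r h.choose).ncard - 1 else 0

theorem IsCompatible.injective (hc : IsCompatible G T r num) : Function.Injective num :=
  Set.injOn_univ.1 hc.bijOn.injOn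

theorem IsCompatible.num_mem (hc : IsCompatible G T r num) (v : V) :
    1 ≤ num v ∧ num v ≤ Fintype.card V :=
  hc.bijOn.mapsTo (Set.mem_univ v)

theorem IsCompatible.exists_num (hc : IsCompatible G T r num) {i : ℕ} (h1 : 1 ≤ i)
    (h2 : i ≤ Fintype.card V) : ∃ v, num v = i := by
  obtain ⟨v, -, hv⟩ := hc.bijOn.surjOn ⟨h1, h2⟩
  exact ⟨v, hv⟩

theorem IsCompatible.lastNum_num (hc : IsCompatible G T r num) (v : V) :
    lastNum T r num (num v) = num v + (desc T r v).ncard - 1 := by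
  have h : ∃ u, num u = num v := ⟨v, rfl⟩
  rw [lastNum, dif_pos h, hc.injective h.choose_spec]

theorem IsCompatible.isAncestor_iff (hc : IsCompatible G T r num) (u v : V) :
    IsAncestor T r u v ↔ num u ≤ num v ∧ num v ≤ lastNum T r num (num u) := by
  have h := hc.interval u
  rw [← hc.lastNum_num] at h
  rw [← Set.mem_Icc, ← h, hc.injective.mem_set_image]
  rfl

theorem IsCompatible.isParent_unique (hT : T.IsTree) (hc : IsCompatible G T r num) {u u' v : V}
    (h : IsParent T r u v) (h' : IsParent T r u' v) : u = u' := by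
  have h1 := ((h.isAncestor_iff hT u').1 h'.2).resolve_left h'.1.ne
  have h2 := ((h'.isAncestor_iff hT u).1 h.2).resolve_left h.1.ne
  rw [hc.isAncestor_iff] at h1 h2
  exact hc.injective (by omega)

theorem IsCompatible.parentNum_num (hT : T.IsTree) (hc : IsCompatible G T r num) {u v : V}
    (h : IsParent T r u v) : parentNum T r num (num v) = num u := by
  have hex : ∃ u' v', num v' = num v ∧ IsParent T r u' v' := ⟨u, v, rfl, h⟩
  rw [parentNum, dif_pos hex]
  obtain ⟨v', h1, h2⟩ := hex.choose_spec
  rw [hc.injective h1] at h2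
  rw [hc.isParent_unique hT h2 h]

theorem IsCompatible.isParent_of_parentNum (hT : T.IsTree) (hc : IsCompatible G T r num)
    {u v : V} (h : parentNum T r num (num v) = num u) : IsParent T r u v := by
  have hu := hc.num_mem u
  by_cases hex : ∃ u' v', num v' = num v ∧ IsParent T r u' v'
  · obtain ⟨u', v', h1, h2⟩ := hex
    rw [hc.injective h1] at h2
    rw [hc.parentNum_num hT h2] at h
    rwa [← hc.injective h]
  · rw [parentNum, dif_neg hex] at h
    omega

theorem IsCompatible.num_root (hT : T.IsTree) (hc : IsCompatible G T r num) : num r = 1 := by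
  have h0 : 1 ≤ Fintype.card V := Fintype.card_pos_iff.2 ⟨r⟩
  obtain ⟨v, hv⟩ := hc.exists_num le_rfl h0
  have := (hc.isAncestor_iff r v).1 (root_isAncestor hT v)
  have := hc.num_mem r
  omega

/-- Only the interval condition of a compatible numbering is used; the order of siblings by their
lowpoints plays no role. -/
theorem IsCompatible.preTree (hT : T.IsTree) (hc : IsCompatible G T r num) :
    PreTree (Fintype.card V) (parentNum T r num) (lastNum T r num) where
  le_last v h1 h2 := by
    obtain ⟨v, rfl⟩ := hc.exists_num h1 h2
    exact ((hc.isAncestor_iff v v).1 (isAncestor_refl hT v)).2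
  last_le v h1 h2 := by
    obtain ⟨v, rfl⟩ := hc.exists_num h1 h2
    have h := hc.interval v
    rw [← hc.lastNum_num] at h
    have hm : lastNum T r num (num v) ∈ num '' desc T r v := by
      rw [h]
      exact ⟨((hc.isAncestor_iff v v).1 (isAncestor_refl hT v)).2, le_rfl⟩
    obtain ⟨u, -, hu⟩ := hm
    rw [← hu]
    exact (hc.num_mem u).2
  par_lt v h1 h2 := by
    obtain ⟨v, rfl⟩ := hc.exists_num h1 h2
    by_cases hex : ∃ u, IsParent T r u v
    · obtain ⟨u, hu⟩ := hex
      rw [hc.parentNum_num hT hu]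
      have h3 := (hc.isAncestor_iff u v).1 hu.2
      have h4 : num u ≠ num v := fun h => hu.1.ne (hc.injective h)
      omega
    · have : ¬ ∃ u' v', num v' = num v ∧ IsParent T r u' v' := by
        rintro ⟨u', v', h3, h4⟩
        rw [hc.injective h3] at h4
        exact hex ⟨u', h4⟩
      rw [parentNum, dif_neg this]
      omega
  par_pos v h1 h2 := by
    obtain ⟨v, rfl⟩ := hc.exists_num (by omega) h2
    have hv : v ≠ r := by
      rintro rfl
      rw [hc.num_root hT] at h1
      omega
    obtain ⟨u, hu⟩ := exists_isParent hT hv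
    rw [hc.parentNum_num hT hu]
    exact (hc.num_mem u).1
  par_zero := by
    have : ¬ ∃ u v, num v = 0 ∧ IsParent T r u v := by
      rintro ⟨u, v, h3, h4⟩
      have := hc.num_mem v
      omega
    rw [parentNum, dif_neg this]
  anc u v hu hun hv hvn := by
    obtain ⟨u, rfl⟩ := hc.exists_num hu hun
    obtain ⟨v, rfl⟩ := hc.exists_num hv hvn
    by_cases hvr : v = r
    · subst hvr
      have h1 := hc.num_root hT
      have : ¬ ∃ u' v', num v' = num v ∧ IsParent T v u' v' := by
        rintro ⟨u', v', h3, h4⟩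
        rw [hc.injective h3] at h4
        exact not_isParent_root hT h4
      rw [parentNum, dif_neg this]
      omega
    · obtain ⟨w, hw⟩ := exists_isParent hT hvr
      rw [hc.parentNum_num hT hw, ← hc.isAncestor_iff]
      have h1 := hw.isAncestor_iff hT u
      have h2 := hc.isAncestor_iff u v
      have h3 := hc.isAncestor_iff w v
      have h4 := hc.isAncestor_iff u w
      have h5 : num w ≠ num v := fun h => hw.1.ne (hc.injective h)
      have h6 := h3.1 hw.2
      constructor
      · rintro ⟨h7, h8⟩
        refine (h1.1 (h2.2 ⟨h7.le, h8⟩)).resolve_left ?_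
        rintro rfl
        omega
      · intro h7
        have := h4.1 h7
        have := h2.1 (h1.2 (Or.inr h7))
        omega

theorem IsCompatible.isLeftChild_iff (hT : T.IsTree) (hc : IsCompatible G T r num) (v c : V) :
    IsLeftChild T r num v c ↔ leftChild (Fintype.card V) (parentNum T r num) (num v) = num c := by
  have hv := hc.num_mem v
  have hcm := hc.num_mem c
  constructor
  · rintro ⟨h1, h2⟩
    have h3 := PreTree.le_leftChild hv.1 hcm.2 (hc.parentNum_num hT h1)
    obtain ⟨d, hd⟩ := hc.exists_num (by omega) (PreTree.leftChild_le (p := parentNum T r num)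
      (num v))
    have h4 := (PreTree.par_leftChild (n := Fintype.card V) (p := parentNum T r num)
      (v := num v) (by omega)).2
    rw [← hd] at h4 h3 ⊢
    exact le_antisymm (h2 d (hc.isParent_of_parentNum hT h4)) h3
  · intro h
    have h4 := (PreTree.par_leftChild (n := Fintype.card V) (p := parentNum T r num)
      (v := num v) (by omega)).2
    rw [h] at h4
    refine ⟨hc.isParent_of_parentNum hT h4, fun d hd => ?_⟩
    rw [← h]
    exact PreTree.le_leftChild hv.1 (hc.num_mem d).2 (hc.parentNum_num hT hd)

/-- The leftmost descendants of `v` are those with the same last descendant. -/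
theorem IsCompatible.isLeftmostDesc_iff (hT : T.IsTree) (hc : IsCompatible G T r num)
    (v w : V) : IsLeftmostDesc T r num v w ↔
      num v ≤ num w ∧ lastNum T r num (num v) = lastNum T r num (num w) := by
  have P := hc.preTree hT
  constructor
  · intro h
    induction h with
    | refl => exact ⟨le_rfl, rfl⟩
    | @tail x y _ hxy ih =>
      rw [hc.isLeftChild_iff hT] at hxy
      have hy := hc.num_mem y
      have h1 := P.lt_leftChild (v := num x) (by omega)
      have h2 := P.last_leftChild (v := num x) (by omega)
      rw [hxy] at h1 h2
      exact ⟨by omega, by omega⟩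
  · rintro ⟨h1, h2⟩
    generalize hk : num w - num v = k
    induction k using Nat.strong_induction_on generalizing v with
    | _ k ih =>
      rcases h1.eq_or_lt with h1 | h1
      · rw [hc.injective h1]
        exact Relation.ReflTransGen.refl
      · obtain ⟨h3, h4⟩ := P.leftChild_of_lt (hc.num_mem v).1 h1 (hc.num_mem w).2 h2
        obtain ⟨c, hcv⟩ := hc.exists_num (by omega) (PreTree.leftChild_le
          (p := parentNum T r num) (num v))
        have h5 := P.lt_leftChild h3
        have h6 := P.last_leftChild h3
        rw [← hcv] at h4 h5 h6
        exact Relation.ReflTransGen.head ((hc.isLeftChild_iff hT v c).2 hcv.symm)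
          (ih _ (by omega) c h4 (by omega) rfl)

/-- The pairs (upper number, lower number) of the ends of the edges in the list `e₁, e₂`, and the
pairs of a vertex and its parent (where the parent of the root is `0`). -/
def EdgeRel (n m : ℕ) (p e₁ e₂ : ℕ → ℕ) (x y : ℕ) : Prop :=
  (1 ≤ x ∧ x ≤ n ∧ y = p x) ∨ ∃ i < m, x = max (e₁ i) (e₂ i) ∧ y = min (e₁ i) (e₂ i)

variable {m : ℕ} {e : Fin m → V × V}

/-- The edges that the machine sees. -/
def inputRel (T : SimpleGraph V) (r : V) (num : V → ℕ) (e : Fin m → V × V) : ℕ → ℕ → Prop :=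
  EdgeRel (Fintype.card V) m (parentNum T r num) ((inputState T r num e).arr 1)
    ((inputState T r num e).arr 2)

theorem inputState_edge (i : ℕ) (hi : i < m) :
    (inputState T r num e).arr 1 i = num (e ⟨i, hi⟩).1 ∧
      (inputState T r num e).arr 2 i = num (e ⟨i, hi⟩).2 := by
  simp [inputState, hi]

theorem inputRel_iff (hN : IsNormalSpanningTree G T r) (hc : IsCompatible G T r num)
    (he : IsEdgeList G e) (x y : V) :
    inputRel T r num e (num x) (num y) ↔ G.Adj x y ∧ num y < num x := by
  have hT := hN.isTree
  constructor
  · rintro (⟨h1, h2, h3⟩ | ⟨i, hi, h1, h2⟩)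
    · have h4 := hc.isParent_of_parentNum hT h3.symm
      have := (hc.preTree hT).par_lt (num x) h1 h2
      exact ⟨(hN.le h4.1).symm, by omega⟩
    · obtain ⟨h3, h4⟩ := inputState_edge (T := T) (r := r) (num := num) (e := e) i hi
      rw [h3, h4] at h1 h2
      have hadj : G.Adj (e ⟨i, hi⟩).1 (e ⟨i, hi⟩).2 := he.mapsTo (Set.mem_univ _)
      have hne : num (e ⟨i, hi⟩).1 ≠ num (e ⟨i, hi⟩).2 := fun h => hadj.ne (hc.injective h)
      rcases le_total (num (e ⟨i, hi⟩).1) (num (e ⟨i, hi⟩).2) with h | h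
      · rw [max_eq_right h] at h1
        rw [min_eq_left h] at h2
        rw [hc.injective h1, hc.injective h2]
        exact ⟨hadj.symm, by omega⟩
      · rw [max_eq_left h] at h1
        rw [min_eq_right h] at h2
        rw [hc.injective h1, hc.injective h2]
        exact ⟨hadj, by omega⟩
  · rintro ⟨hadj, hlt⟩
    right
    obtain ⟨⟨i, hi⟩, -, h⟩ := he.surjOn (show s(x, y) ∈ G.edgeSet from hadj)
    obtain ⟨h3, h4⟩ := inputState_edge (T := T) (r := r) (num := num) (e := e) i hi
    refine ⟨i, hi, ?_⟩
    rw [h3, h4]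
    rcases Sym2.eq_iff.1 h with ⟨h1, h2⟩ | ⟨h1, h2⟩
    · rw [h1, h2, max_eq_left hlt.le, min_eq_right hlt.le]
      exact ⟨rfl, rfl⟩
    · rw [h1, h2, max_eq_right hlt.le, min_eq_left hlt.le]
      exact ⟨rfl, rfl⟩

theorem inputRel_mem (hN : IsNormalSpanningTree G T r) (hc : IsCompatible G T r num)
    {x y : ℕ} (h : inputRel T r num e x y) :
    1 ≤ x ∧ x ≤ Fintype.card V ∧ (2 ≤ x → 1 ≤ y) := by
  rcases h with ⟨h1, h2, h3⟩ | ⟨i, hi, h1, h2⟩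
  · refine ⟨h1, h2, fun h4 => ?_⟩
    have := (hc.preTree hN.isTree).par_pos x h4 h2
    omega
  · obtain ⟨h3, h4⟩ := inputState_edge (T := T) (r := r) (num := num) (e := e) i hi
    have := hc.num_mem (e ⟨i, hi⟩).1
    have := hc.num_mem (e ⟨i, hi⟩).2
    omega

/-- Stability in terms of all edges instead of the back-edges: a tree edge from a vertex in question
leads to its parent, which is at least `α`. -/
theorem isStable_iff (hN : IsNormalSpanningTree G T r) (hc : IsCompatible G T r num)
    (he : IsEdgeList G e) (α b : V) :
    IsStable G T r num α b ↔ ∃ w, 1 ≤ w ∧ w ≤ num b ∧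
      lastNum T r num w = lastNum T r num (num b) ∧
      Valid (inputRel T r num e) (parentNum T r num) w (num b) ∧
      parentNum T r num w = num α := by
  have hT := hN.isTree
  have P := hc.preTree hT
  have hα := hc.num_mem α
  have hb := hc.num_mem b
  constructor
  · rintro ⟨w, h1, h2, h3⟩
    have hp := hc.parentNum_num hT h1
    rw [hc.isLeftmostDesc_iff hT] at h2
    have hw := hc.num_mem w
    refine ⟨num w, hw.1, h2.1, h2.2, ?_, hp⟩
    intro x y hE hwx hxb
    have hpw := P.par_lt (num w) hw.1 hw.2
    obtain ⟨hx1, hx2, hy⟩ := inputRel_mem hN hc hE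
    -- `x` is not the root, since it is numbered at least `w`, a child of `α`
    have hy1 : 1 ≤ y := hy (by omega)
    have hblast := P.le_last (num b) hb.1 hb.2
    have hanc := (P.anc (num α) x hα.1 hα.2 hx1 hx2).1
      ⟨by omega, by
        have := P.le_last_par (c := num w) (by omega) hw.1 hw.2
        have := P.last_mono (by omega) hpw.le this (by omega)
        rw [hp] at this
        omega⟩
    by_cases hyp : y = parentNum T r num x
    · omega
    obtain ⟨x, rfl⟩ := hc.exists_num hx1 hx2
    have hyn : y ≤ Fintype.card V := by
      rcases hE with ⟨_, _, h⟩ | ⟨i, hi, _, h⟩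
      · exact absurd h hyp
      · obtain ⟨h5, h6⟩ := inputState_edge (T := T) (r := r) (num := num) (e := e) i hi
        have := hc.num_mem (e ⟨i, hi⟩).1
        omega
    obtain ⟨y, rfl⟩ := hc.exists_num hy1 hyn
    obtain ⟨hadj, hlt⟩ := (inputRel_iff hN hc he x y).1 hE
    have hyx : IsAncestor T r y x := by
      rcases hN.comparable x y hadj with h | h
      · have := ((hc.isAncestor_iff x y).1 h).1
        omega
      · exact h
    rw [hp]
    refine h3 x y ⟨hadj, fun hTadj => hyp ?_, hyx⟩ hwx hxb
    exact (hc.parentNum_num hT ⟨hTadj.symm, hyx⟩).symm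
  · rintro ⟨w, h1, h2, h3, h4, h5⟩
    obtain ⟨w, rfl⟩ := hc.exists_num h1 (h2.trans hb.2)
    refine ⟨w, hc.isParent_of_parentNum hT h5, (hc.isLeftmostDesc_iff hT w b).2 ⟨h2, h3⟩, ?_⟩
    intro x y hxy hwx hxb
    have hanc := (hc.isAncestor_iff y x).1 hxy.2.2
    have hne : num y ≠ num x := fun h => hxy.1.ne (hc.injective h).symm
    have := h4 (num x) (num y) ((inputRel_iff hN hc he x y).2 ⟨hxy.1, by omega⟩) hwx hxb
    omega

theorem isLeftmostPath_iff (hN : IsNormalSpanningTree G T r) (hc : IsCompatible G T r num)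
    (a b : V) :
    IsLeftmostPath T r num a b ↔ ∃ w, 1 ≤ w ∧ w ≤ num b ∧
      lastNum T r num w = lastNum T r num (num b) ∧ parentNum T r num w = num a := by
  have hT := hN.isTree
  constructor
  · rintro ⟨w, h1, h2⟩
    rw [hc.isLeftmostDesc_iff hT] at h2
    exact ⟨num w, (hc.num_mem w).1, h2.1, h2.2, hc.parentNum_num hT h1⟩
  · rintro ⟨w, h1, h2, h3, h4⟩
    obtain ⟨w, rfl⟩ := hc.exists_num h1 (h2.trans (hc.num_mem b).2)
    exact ⟨w, hc.isParent_of_parentNum hT h4, (hc.isLeftmostDesc_iff hT w b).2 ⟨h2, h3⟩⟩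

theorem stab_eq_zero (hN : IsNormalSpanningTree G T r) (hc : IsCompatible G T r num) (a b : V)
    (h : ¬ ∃ w, 1 ≤ w ∧ w ≤ num b ∧
      lastNum T r num w = lastNum T r num (num b) ∧ parentNum T r num w = num a) :
    stab G T r num a b = 0 := by
  rw [stab, if_neg]
  rwa [isLeftmostPath_iff hN hc]

/-- The value of `stab` is determined by the largest valid vertex of the leftmost path at or above
the child `w` of `a`. -/
theorem stab_eq_of_isGreatest (hN : IsNormalSpanningTree G T r) (hc : IsCompatible G T r num)
    (he : IsEdgeList G e) (a b : V) {w k : ℕ} (hw : 1 ≤ w) (hwb : w ≤ num b)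
    (hl : lastNum T r num w = lastNum T r num (num b)) (hp : parentNum T r num w = num a)
    (hle : ∀ u, 1 ≤ u → u ≤ w → lastNum T r num u = lastNum T r num (num b) →
      Valid (inputRel T r num e) (parentNum T r num) u (num b) → parentNum T r num u ≤ k)
    (hk : k ≠ 0 → ∃ u, 1 ≤ u ∧ u ≤ w ∧ lastNum T r num u = lastNum T r num (num b) ∧
      Valid (inputRel T r num e) (parentNum T r num) u (num b) ∧ k = parentNum T r num u) :
    stab G T r num a b = k := by
  have hT := hN.isTree
  have P := hc.preTree hT
  have ha := hc.num_mem a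
  have hb := hc.num_mem b
  rw [stab, if_pos ((isLeftmostPath_iff hN hc a b).2 ⟨w, hw, hwb, hl, hp⟩)]
  have hset : ∀ j ∈ {j | ∃ α, IsAncestor T r α a ∧ IsStable G T r num α b ∧ num α = j}, j ≤ k := by
    rintro j ⟨α, h1, h2, rfl⟩
    obtain ⟨u, u1, u2, u3, u4, u5⟩ := (isStable_iff hN hc he α b).1 h2
    rw [← u5]
    refine hle u u1 ?_ u3 u4
    -- if `u` were greater than `w`, its parent would be greater than `a`
    by_contra hcon
    have h3 := (P.par_of_lt hw (by omega : w < u) (by omega) (by omega)).1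
    have h4 := ((hc.isAncestor_iff α a).1 h1).1
    have := P.par_lt w hw (by omega)
    omega
  rcases Nat.eq_zero_or_pos k with rfl | hkpos
  · refine Nat.eq_zero_of_le_zero ?_
    rcases Set.eq_empty_or_nonempty
      {j | ∃ α, IsAncestor T r α a ∧ IsStable G T r num α b ∧ num α = j} with h | h
    · rw [h, csSup_empty]; rfl
    · exact csSup_le h hset
  · obtain ⟨u, u1, u2, u3, u4, u5⟩ := hk (by omega)
    have hmem : k ∈ {j | ∃ α, IsAncestor T r α a ∧ IsStable G T r num α b ∧ num α = j} := by
      have hpu := P.par_lt u u1 (by omega)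
      obtain ⟨α, hα⟩ := hc.exists_num (i := k) (by omega) (by omega)
      refine ⟨α, ?_, (isStable_iff hN hc he α b).2 ⟨u, u1, by omega, u3, u4, by omega⟩, hα⟩
      rw [hc.isAncestor_iff, hα, ← hp, u5]
      refine ⟨P.par_mono u1 u2 (by omega) (by omega), ?_⟩
      have h1 := P.le_last_par (c := u) (by omega) u1 (by omega)
      have h2 := P.last_mono (by omega) hpu.le h1 (by omega)
      have h3 := P.par_lt w hw (by omega)
      have h4 := P.le_last w hw (by omega)
      omega
    exact le_antisymm (csSup_le ⟨k, hmem⟩ hset) (le_csSup ⟨k, hset⟩ hmem)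

end Numbering

/-! ### Reasoning about programs -/

/-- Started in `s`, the program `c` halts within `K` steps in a state that satisfies `Q`. -/
def Runs (w : ℕ) (c : Cmd) (s : State) (K : ℕ) (Q : State → Prop) : Prop :=
  ∃ t s', Exec w c s t s' ∧ t ≤ K ∧ Q s'

theorem Runs.mono {w : ℕ} {c : Cmd} {s : State} {K K' : ℕ} {Q Q' : State → Prop}
    (h : Runs w c s K Q) (hK : K ≤ K') (hQ : ∀ s', Q s' → Q' s') : Runs w c s K' Q' := by
  obtain ⟨t, s', h1, h2, h3⟩ := h
  exact ⟨t, s', h1, h2.trans hK, hQ s' h3⟩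

theorem Runs.seq {w : ℕ} {c₁ c₂ : Cmd} {s : State} {K₁ K₂ : ℕ} {Q R : State → Prop}
    (h₁ : Runs w c₁ s K₁ Q) (h₂ : ∀ s', Q s' → Runs w c₂ s' K₂ R) :
    Runs w (.seq c₁ c₂) s (K₁ + K₂) R := by
  obtain ⟨t, s', h1, h2, h3⟩ := h₁
  obtain ⟨t', s'', h4, h5, h6⟩ := h₂ s' h3
  exact ⟨_, s'', .seq h1 h4, by omega, h6⟩

/-- The rule for loops: a measure that decreases in every round bounds the number of rounds. -/
theorem Runs.loop {w : ℕ} {e : Expr} {c : Cmd} {K : ℕ} (I : State → Prop) (μ : State → ℕ)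
    (step : ∀ s, I s → e.eval w s ≠ 0 → Runs w c s K fun s' => I s' ∧ μ s' < μ s)
    {s : State} (hs : I s) :
    Runs w (.loop e c) s (μ s * (e.cost + 1 + K) + (e.cost + 1))
      fun s' => I s' ∧ e.eval w s' = 0 := by
  generalize hk : μ s = k
  induction k using Nat.strong_induction_on generalizing s with
  | _ k ih =>
    by_cases he : e.eval w s = 0
    · exact ⟨_, s, .loop_false he, by omega, hs, he⟩
    · obtain ⟨t, s', h1, h2, h3, h4⟩ := step s hs he
      obtain ⟨t', s'', h5, h6, h7⟩ := ih (μ s') (hk ▸ h4) h3 rfl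
      refine ⟨_, s'', .loop_true he h1 h5, ?_, h7⟩
      have : (μ s' + 1) * (e.cost + 1 + K) ≤ k * (e.cost + 1 + K) :=
        Nat.mul_le_mul_right _ (by omega)
      rw [Nat.add_mul] at this
      omega

/-- The program has no loop. -/
def Cmd.straight : Cmd → Bool
  | .nop => true
  | .assign _ _ => true
  | .write _ _ _ => true
  | .seq c₁ c₂ => c₁.straight && c₂.straight
  | .branch _ c₁ c₂ => c₁.straight && c₂.straight
  | .loop _ _ => false

/-- The final state of a program without loops. -/
def Cmd.run (w : ℕ) : Cmd → State → State
  | .nop, s => s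
  | .assign x e, s => s.setVar x (e.eval w s)
  | .write k i e, s => s.setArr k (i.eval w s) (e.eval w s)
  | .seq c₁ c₂, s => c₂.run w (c₁.run w s)
  | .branch e c₁ c₂, s => if e.eval w s ≠ 0 then c₁.run w s else c₂.run w s
  | .loop _ _, s => s

/-- An upper bound for the running time of a program in which every loop makes only one test and
one round. -/
def Cmd.time : Cmd → ℕ
  | .nop => 1
  | .assign _ e => e.cost + 1
  | .write _ i e => i.cost + e.cost + 1
  | .seq c₁ c₂ => c₁.time + c₂.time
  | .branch e c₁ c₂ => e.cost + 1 + (c₁.time + c₂.time)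
  | .loop e c => e.cost + 1 + c.time

theorem Cmd.exec_run (w : ℕ) (c : Cmd) (hc : c.straight = true) (s : State) :
    ∃ t ≤ c.time, Exec w c s t (c.run w s) := by
  induction c generalizing s with
  | nop => exact ⟨1, le_rfl, .nop s⟩
  | assign x e => exact ⟨_, le_rfl, .assign x e s⟩
  | write k i e => exact ⟨_, le_rfl, .write k i e s⟩
  | seq c₁ c₂ ih₁ ih₂ =>
    simp only [Cmd.straight, Bool.and_eq_true] at hc
    obtain ⟨t₁, h1, h2⟩ := ih₁ hc.1 s
    obtain ⟨t₂, h3, h4⟩ := ih₂ hc.2 (c₁.run w s)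
    exact ⟨_, Nat.add_le_add h1 h3, .seq h2 h4⟩
  | branch e c₁ c₂ ih₁ ih₂ =>
    simp only [Cmd.straight, Bool.and_eq_true] at hc
    by_cases he : e.eval w s = 0
    · obtain ⟨t, h1, h2⟩ := ih₂ hc.2 s
      refine ⟨_, ?_, .branch_false he (by simpa [Cmd.run, he] using h2)⟩
      simp only [Cmd.time]
      omega
    · obtain ⟨t, h1, h2⟩ := ih₁ hc.1 s
      refine ⟨_, ?_, .branch_true he (by simpa [Cmd.run, he] using h2)⟩
      simp only [Cmd.time]
      omega
  | loop e c => simp [Cmd.straight] at hc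

theorem Runs.straight {w : ℕ} {c : Cmd} {s : State} {K : ℕ} {Q : State → Prop}
    (hc : c.straight = true) (hK : c.time ≤ K) (hQ : Q (c.run w s)) : Runs w c s K Q := by
  obtain ⟨t, h1, h2⟩ := c.exec_run w hc s
  exact ⟨t, _, h2, h1.trans hK, hQ⟩

/-- A loop with a loop-free body, after a loop-free initialization. If there are fewer than `L`
rounds, the running time is at most `L` times that of one round. -/
theorem Runs.init_loop {w : ℕ} {c₀ : Cmd} {e : Expr} {c : Cmd} {s : State} {L : ℕ}
    {Q : State → Prop} (I : State → Prop) (μ : State → ℕ)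
    (hc₀ : c₀.straight = true) (hc : c.straight = true)
    (hI : I (c₀.run w s)) (hμ : μ (c₀.run w s) < L)
    (step : ∀ s, I s → e.eval w s ≠ 0 → I (c.run w s) ∧ μ (c.run w s) < μ s)
    (post : ∀ s', I s' → e.eval w s' = 0 → Q s') :
    Runs w (.seq c₀ (.loop e c)) s (L * (Cmd.seq c₀ (.loop e c)).time) Q := by
  have hseq : Runs w (.seq c₀ (.loop e c)) s (c₀.time +
      (μ (c₀.run w s) * (e.cost + 1 + c.time) + (e.cost + 1)))
      fun s' => I s' ∧ e.eval w s' = 0 := by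
    refine Runs.seq (Q := fun s' => s' = c₀.run w s) (Runs.straight hc₀ le_rfl rfl) ?_
    rintro s' rfl
    exact Runs.loop I μ (fun s h1 h2 => Runs.straight hc le_rfl (step s h1 h2)) hI
  refine hseq.mono ?_ fun s' h => post s' h.1 h.2
  simp only [Cmd.time]
  calc _ ≤ (μ (c₀.run w s) + 1) * (c₀.time + (e.cost + 1 + c.time)) := by
        nlinarith [Nat.zero_le (μ (c₀.run w s) * c₀.time)]
    _ ≤ _ := Nat.mul_le_mul_right _ hμ

/-- The program does not assign to the variable `x`. -/
def Cmd.keepsVar (x : ℕ) : Cmd → Bool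
  | .nop => true
  | .assign y _ => x != y
  | .write _ _ _ => true
  | .seq c₁ c₂ => c₁.keepsVar x && c₂.keepsVar x
  | .branch _ c₁ c₂ => c₁.keepsVar x && c₂.keepsVar x
  | .loop _ c => c.keepsVar x

/-- The program does not write to the array `k`. -/
def Cmd.keepsArr (k : ℕ) : Cmd → Bool
  | .nop => true
  | .assign _ _ => true
  | .write l _ _ => k != l
  | .seq c₁ c₂ => c₁.keepsArr k && c₂.keepsArr k
  | .branch _ c₁ c₂ => c₁.keepsArr k && c₂.keepsArr k
  | .loop _ c => c.keepsArr k

theorem Exec.var_eq {w : ℕ} {c : Cmd} {s s' : State} {t x : ℕ} (h : Exec w c s t s')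
    (hx : c.keepsVar x = true) : s'.var x = s.var x := by
  induction h with
  | nop => rfl
  | assign y e s =>
    simp only [Cmd.keepsVar, bne_iff_ne] at hx
    simp [State.setVar, Function.update_of_ne hx]
  | write => rfl
  | seq _ _ ih₁ ih₂ =>
    simp only [Cmd.keepsVar, Bool.and_eq_true] at hx
    exact (ih₂ hx.2).trans (ih₁ hx.1)
  | branch_true _ _ ih =>
    simp only [Cmd.keepsVar, Bool.and_eq_true] at hx
    exact ih hx.1
  | branch_false _ _ ih =>
    simp only [Cmd.keepsVar, Bool.and_eq_true] at hx
    exact ih hx.2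
  | loop_true _ _ _ ih₁ ih₂ => exact (ih₂ hx).trans (ih₁ hx)
  | loop_false => rfl

theorem Exec.arr_eq {w : ℕ} {c : Cmd} {s s' : State} {t k : ℕ} (h : Exec w c s t s')
    (hk : c.keepsArr k = true) : s'.arr k = s.arr k := by
  induction h with
  | nop => rfl
  | assign => rfl
  | write l i e s =>
    simp only [Cmd.keepsArr, bne_iff_ne] at hk
    simp [State.setArr, Function.update_of_ne hk]
  | seq _ _ ih₁ ih₂ =>
    simp only [Cmd.keepsArr, Bool.and_eq_true] at hk
    exact (ih₂ hk.2).trans (ih₁ hk.1)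
  | branch_true _ _ ih =>
    simp only [Cmd.keepsArr, Bool.and_eq_true] at hk
    exact ih hk.1
  | branch_false _ _ ih =>
    simp only [Cmd.keepsArr, Bool.and_eq_true] at hk
    exact ih hk.2
  | loop_true _ _ _ ih₁ ih₂ => exact (ih₂ hk).trans (ih₁ hk)
  | loop_false => rfl

/-- A program keeps the variables and arrays to which it does not write. -/
theorem Runs.frame {w : ℕ} {c : Cmd} {s : State} {K : ℕ} {Q : State → Prop}
    (h : Runs w c s K Q) : Runs w c s K fun s' => Q s' ∧
      (∀ x, c.keepsVar x = true → s'.var x = s.var x) ∧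
      ∀ k, c.keepsArr k = true → s'.arr k = s.arr k := by
  obtain ⟨t, s', h1, h2, h3⟩ := h
  exact ⟨t, s', h1, h2, h3, fun _ => h1.var_eq, fun _ => h1.arr_eq⟩

@[simp] theorem State.setVar_var (s : State) (x v y : ℕ) :
    (s.setVar x v).var y = if y = x then v else s.var y := by
  simp [State.setVar, Function.update_apply]

@[simp] theorem State.setVar_arr (s : State) (x v : ℕ) : (s.setVar x v).arr = s.arr := rfl

@[simp] theorem State.setArr_var (s : State) (k i v : ℕ) : (s.setArr k i v).var = s.var := rfl

@[simp] theorem State.setArr_arr (s : State) (k i v l : ℕ) :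
    (s.setArr k i v).arr l = if l = k then Function.update (s.arr k) i v else s.arr l := by
  simp only [State.setArr, Function.update_apply]

instance : Add Expr := ⟨.bin .add⟩
instance : Sub Expr := ⟨.bin .sub⟩
instance : Mul Expr := ⟨.bin .mul⟩
instance : Div Expr := ⟨.bin .div⟩
instance : Mod Expr := ⟨.bin .mod⟩
instance (k : ℕ) : OfNat Expr k := ⟨.lit k⟩

/-- The test `e₁ < e₂`. -/
def Expr.lt (e₁ e₂ : Expr) : Expr := .bin .lt e₁ e₂

/-- The test `e₁ = e₂`. -/
def Expr.eq (e₁ e₂ : Expr) : Expr := .bin .eq e₁ e₂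

/-- The minimum of two numbers, computed as `e₁ - (e₁ - e₂)` with truncated subtraction. -/
def Expr.min (e₁ e₂ : Expr) : Expr := e₁ - (e₁ - e₂)

section Eval

variable (w : ℕ) (s : State) (e₁ e₂ : Expr)

@[simp] theorem Expr.eval_add : (e₁ + e₂).eval w s = (e₁.eval w s + e₂.eval w s) % 2 ^ w := rfl
@[simp] theorem Expr.eval_sub : (e₁ - e₂).eval w s = e₁.eval w s - e₂.eval w s := rfl
@[simp] theorem Expr.eval_mul : (e₁ * e₂).eval w s = (e₁.eval w s * e₂.eval w s) % 2 ^ w := rfl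
@[simp] theorem Expr.eval_div : (e₁ / e₂).eval w s = e₁.eval w s / e₂.eval w s := rfl
@[simp] theorem Expr.eval_mod : (e₁ % e₂).eval w s = e₁.eval w s % e₂.eval w s := rfl
@[simp] theorem Expr.eval_lt : (e₁.lt e₂).eval w s = if e₁.eval w s < e₂.eval w s then 1 else 0 := rfl
@[simp] theorem Expr.eval_eq : (e₁.eq e₂).eval w s = if e₁.eval w s = e₂.eval w s then 1 else 0 := rfl

@[simp] theorem Expr.eval_min : (e₁.min e₂).eval w s = Min.min (e₁.eval w s) (e₂.eval w s) := by
  simp only [Expr.min, Expr.eval_sub]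
  omega

@[simp] theorem Expr.eval_zero : (0 : Expr).eval w s = 0 := Nat.zero_mod _
@[simp] theorem Expr.eval_one : (1 : Expr).eval w s = 1 % 2 ^ w := rfl
@[simp] theorem Expr.eval_two : (2 : Expr).eval w s = 2 % 2 ^ w := rfl

@[simp] theorem Expr.eval_var (x : ℕ) : (Expr.var x).eval w s = s.var x := rfl

@[simp] theorem Expr.eval_get (k : ℕ) (i : Expr) : (Expr.get k i).eval w s = s.arr k (i.eval w s) := rfl

end Eval

theorem mod_small {w x : ℕ} (h : x < 2 ^ w) : x % 2 ^ w = x := Nat.mod_eq_of_lt h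

/-! ### Names of the variables and arrays of the machine -/

-- `vN`, `vM`: the input sizes; `vSize`, `vBlocks`: length and number of the blocks, which queries
-- read; `vTop`: the power of two `2 ^ vSize`; `vA`, `vB`: the query; the others are temporary.
notation "vN" => (0 : ℕ)
notation "vM" => (1 : ℕ)
notation "vSize" => (2 : ℕ)
notation "vTop" => (3 : ℕ)
notation "vBlocks" => (4 : ℕ)
notation "vI" => (5 : ℕ)
notation "vJ" => (6 : ℕ)
notation "vK" => (7 : ℕ)
notation "vL" => (8 : ℕ)

notation "vA" => (0 : ℕ)
notation "vB" => (1 : ℕ)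
notation "vP" => (9 : ℕ)
notation "vQ" => (10 : ℕ)

-- `aPar`, `aFst`, `aSnd`: the input; `aLeft`: left children; `aOwn`, `aLow`: least targets, see
-- `IsOwnLow` and `IsLow`; `aHead`: see `IsHead`; `aNext`: `nextValid`; `aVal`: see `IsValue`;
-- `aPow`, `aLog`, `aBit`: powers of two, binary logarithms, positions of lowest bits; `aMask`,
-- `aMin`: see `IsMask` and `IsSparseTable`.
notation "aPar" => (0 : ℕ)
notation "aFst" => (1 : ℕ)
notation "aSnd" => (2 : ℕ)
notation "aLeft" => (3 : ℕ)
notation "aOwn" => (4 : ℕ)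
notation "aLow" => (5 : ℕ)
notation "aHead" => (6 : ℕ)
notation "aNext" => (7 : ℕ)
notation "aVal" => (8 : ℕ)
notation "aPow" => (9 : ℕ)
notation "aLog" => (10 : ℕ)
notation "aBit" => (11 : ℕ)
notation "aMask" => (12 : ℕ)
notation "aMin" => (13 : ℕ)

infixr:60 " ;; " => Cmd.seq

/-! ### Tables of powers, logarithms and lowest bits -/

/-- Computes the least power of two above `n`, and the table of the smaller ones. -/
def powCmd : Cmd :=
  (.assign vTop 1 ;; .assign vSize 0) ;;
  .loop ((Expr.var vTop).lt (.var vN + 1))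
    (.write aPow (.var vSize) (.var vTop) ;;
     .assign vTop (.var vTop + .var vTop) ;;
     .assign vSize (.var vSize + 1))

theorem runs_powCmd {w n L : ℕ} (hw : 100 * (n + 1) ≤ 2 ^ w) (hn1 : 1 ≤ n) (hL : n < L)
    {s : State} (hn : s.var vN = n) :
    Runs w powCmd s (L * powCmd.time) fun s' =>
      s'.var vTop = 2 ^ s'.var vSize ∧ n < 2 ^ s'.var vSize ∧ 2 ^ s'.var vSize ≤ 2 * n ∧
        ∀ k < s'.var vSize, s'.arr aPow k = 2 ^ k := by
  refine Runs.init_loop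
    (fun s' => s'.var vN = n ∧ s'.var vTop = 2 ^ s'.var vSize ∧ 2 ^ s'.var vSize ≤ 2 * n ∧
      ∀ k < s'.var vSize, s'.arr aPow k = 2 ^ k)
    (fun s' => n - s'.var vSize) rfl rfl ?_ ?_ ?_ ?_
  · simp (disch := omega) [Cmd.run, mod_small, hn]
    omega
  · simp (disch := omega) [Cmd.run, mod_small]
    omega
  · rintro s' ⟨i1, i2, i3, i4⟩ ht
    simp (disch := omega) [i1, mod_small] at ht
    have hlt : s'.var vSize < 2 ^ s'.var vSize := Nat.lt_two_pow_self
    simp (disch := omega) [Cmd.run, mod_small, i1]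
    refine ⟨⟨by rw [pow_succ]; omega, by rw [pow_succ]; omega, fun k hk => ?_⟩, by omega⟩
    rw [Function.update_apply]
    split_ifs with h
    · rw [h, i2]
    · exact i4 k (by omega)
  · rintro s' ⟨i1, i2, i3, i4⟩ ht
    simp (disch := omega) [i1, mod_small] at ht
    exact ⟨i2, by omega, i3, i4⟩

/-- `b` is the position of the lowest bit of `x`. -/
def IsLowBit (x b : ℕ) : Prop :=
  x.testBit b = true ∧ ∀ k < b, x.testBit k = false

theorem IsLowBit.lt {x b : ℕ} (h : IsLowBit x b) : b < x :=
  lt_of_lt_of_le Nat.lt_two_pow_self (Nat.ge_two_pow_of_testBit h.1)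

/-- The recursion for the lowest bit, in the form in which the machine computes it. -/
theorem isLowBit_step {x b : ℕ} (h : x / 2 ≠ 0 → IsLowBit (x / 2) b) (hx : x ≠ 0) :
    IsLowBit x ((1 - x % 2) * (b + 1)) := by
  rcases Nat.mod_two_eq_zero_or_one x with h2 | h2
  · have := h (by omega)
    rw [h2]
    simp only [Nat.sub_zero, Nat.one_mul]
    refine ⟨by rw [Nat.testBit_succ]; exact this.1, fun k hk => ?_⟩
    cases k with
    | zero => rw [Nat.testBit_zero, h2]; rfl
    | succ k => rw [Nat.testBit_succ]; exact this.2 k (by omega)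
  · rw [h2]
    simp [IsLowBit, h2]

/-- Computes the tables of binary logarithms and of positions of lowest bits. -/
def tableCmd : Cmd :=
  .assign vI 2 ;;
  .loop ((Expr.var vI).lt (.var vTop))
    (.write aLog (.var vI) (.get aLog (.var vI / 2) + 1) ;;
     .write aBit (.var vI) ((1 - .var vI % 2) * (.get aBit (.var vI / 2) + 1)) ;;
     .assign vI (.var vI + 1))

theorem runs_tableCmd {w L top : ℕ} (hw : 10 * (top + 1) ≤ 2 ^ w) (h2 : 2 ≤ top) (hL : top < L)
    {s : State} (hn : s.var vTop = top) (h0 : s.arr aLog = fun _ => 0)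
    (h1 : s.arr aBit = fun _ => 0) :
    Runs w tableCmd s (L * tableCmd.time) fun s' =>
      (∀ x < top, s'.arr aLog x = Nat.log 2 x) ∧
        ∀ x, 1 ≤ x → x < top → IsLowBit x (s'.arr aBit x) := by
  refine Runs.init_loop
    (fun s' => s'.var vTop = top ∧ 2 ≤ s'.var vI ∧ s'.var vI ≤ top ∧
      (∀ x < s'.var vI, s'.arr aLog x = Nat.log 2 x) ∧
        ∀ x, 1 ≤ x → x < s'.var vI → IsLowBit x (s'.arr aBit x))
    (fun s' => top - s'.var vI) rfl rfl ?_ ?_ ?_ ?_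
  · simp (disch := omega) [Cmd.run, mod_small, hn, h0, h1, h2]
    refine ⟨fun x hx => ?_, fun x hx hx2 => ?_⟩
    · exact (Nat.log_of_lt (by omega)).symm
    · obtain rfl : x = 1 := by omega
      simp [IsLowBit]
  · simp (disch := omega) [Cmd.run, mod_small]
    omega
  · rintro s' ⟨i1, i2, i3, i4, i5⟩ ht
    simp (disch := omega) [i1] at ht
    have hlog := i4 (s'.var vI / 2) (by omega)
    have hlog2 : Nat.log 2 (s'.var vI / 2) < 2 ^ w := by
      have := Nat.log_le_self 2 (s'.var vI / 2)
      omega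
    have hlog3 : Nat.log 2 (s'.var vI / 2) + 1 = Nat.log 2 (s'.var vI) :=
      (Nat.log_of_one_lt_of_le (by omega) i2).symm
    have hbit := i5 (s'.var vI / 2) (by omega) (by omega)
    have hlt := hbit.lt
    have hstep := isLowBit_step (fun _ => hbit) (x := s'.var vI) (by omega)
    have hlt' := hstep.lt
    have hlog4 := Nat.log_le_self 2 (s'.var vI)
    simp (disch := omega) [Cmd.run, mod_small, i1, hlog]
    refine ⟨⟨by omega, by omega, fun x hx => ?_, fun x hx hx2 => ?_⟩, by omega⟩
    · rw [Function.update_apply]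
      split_ifs with h
      · rw [h]
      · exact i4 x (by omega)
    · rw [Function.update_apply]
      split_ifs with h
      · rw [h]
        exact hstep
      · exact i5 x hx (by omega)
  · rintro s' ⟨i1, i2, i3, i4, i5⟩ ht
    simp (disch := omega) [i1] at ht
    exact ⟨fun x hx => i4 x (by omega), fun x hx hx2 => i5 x hx (by omega)⟩

/-! ### Left children and lowest targets -/

/-- Computes the left children, and the parents as first approximations of the least targets. -/
def leftCmd : Cmd :=
  .assign vI 1 ;;
  .loop ((Expr.var vI).lt (.var vN + 1))
    (.write aLeft (.get aPar (.var vI)) (.var vI) ;;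
     .write aOwn (.var vI) (.get aPar (.var vI)) ;;
     .assign vI (.var vI + 1))

theorem runs_leftCmd {w n L : ℕ} {p : ℕ → ℕ} (hw : 100 * (n + 1) ≤ 2 ^ w) (hL : n < L)
    {s : State} (hn : s.var vN = n) (hp : s.arr aPar = p) (h0 : s.arr aLeft = fun _ => 0) :
    Runs w leftCmd s (L * leftCmd.time) fun s' =>
      (∀ v, 1 ≤ v → s'.arr aLeft v = leftChild n p v) ∧
        ∀ v, 1 ≤ v → v ≤ n → s'.arr aOwn v = p v := by
  refine Runs.init_loop
    (fun s' => s'.var vN = n ∧ s'.arr aPar = p ∧ 1 ≤ s'.var vI ∧ s'.var vI ≤ n + 1 ∧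
      (∀ v, 1 ≤ v → s'.arr aLeft v =
        Nat.findGreatest (fun c => 1 ≤ v ∧ p c = v) (s'.var vI - 1)) ∧
      ∀ v, 1 ≤ v → v < s'.var vI → s'.arr aOwn v = p v)
    (fun s' => n + 1 - s'.var vI) rfl rfl ?_ ?_ ?_ ?_
  · simp (disch := omega) [Cmd.run, mod_small, hn, hp, h0]
    omega
  · simp (disch := omega) [Cmd.run, mod_small]
    omega
  · rintro s' ⟨i1, i2, i3, i4, i5, i6⟩ ht
    simp (disch := omega) [i1, mod_small] at ht
    simp (disch := omega) [Cmd.run, mod_small, i1, i2]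
    refine ⟨⟨by omega, ?_, ?_⟩, by omega⟩
    · intro v hv
      obtain ⟨i, hi⟩ : ∃ i, s'.var vI = i + 1 := ⟨s'.var vI - 1, by omega⟩
      rw [hi] at i5 ⊢
      simp only [Nat.add_sub_cancel] at i5
      rw [Nat.findGreatest_succ, Function.update_apply, ← i5 v hv]
      simp only [hv, true_and, eq_comm]
    · intro v hv hvi
      rw [Function.update_apply]
      split_ifs with h
      · rw [h]
      · exact i6 v hv (by omega)
  · rintro s' ⟨i1, i2, i3, i4, i5, i6⟩ ht
    simp (disch := omega) [i1, mod_small] at ht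
    have : s'.var vI = n + 1 := by omega
    rw [this] at i5 i6
    exact ⟨i5, fun v h1 h2 => i6 v h1 (by omega)⟩

/-- Computes the least target of the edges from every vertex. -/
def ownCmd : Cmd :=
  (.write aLeft 0 0 ;; .assign vI 0) ;;
  .loop ((Expr.var vI).lt (.var vM))
    (.assign vJ (.get aFst (.var vI)) ;;
     .assign vK (.get aSnd (.var vI)) ;;
     .branch ((Expr.var vJ).lt (.var vK))
       (.write aOwn (.var vK) ((Expr.get aOwn (.var vK)).min (.var vJ)))
       (.write aOwn (.var vJ) ((Expr.get aOwn (.var vJ)).min (.var vK))) ;;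
     .assign vI (.var vI + 1))

theorem runs_ownCmd {w n m L : ℕ} {p e₁ e₂ : ℕ → ℕ} (hw : 100 * (n + m + 1) ≤ 2 ^ w)
    (hL : m < L) {s : State} (hm : s.var vM = m)
    (h1 : s.arr aFst = e₁) (h2 : s.arr aSnd = e₂)
    (hl : ∀ v, 1 ≤ v → s.arr aLeft v = leftChild n p v)
    (ho : ∀ v, 1 ≤ v → v ≤ n → s.arr aOwn v = p v) :
    Runs w ownCmd s (L * ownCmd.time) fun s' =>
      s'.arr aLeft = leftChild n p ∧
        ∀ v, 1 ≤ v → v ≤ n → ∀ α, α ≤ s'.arr aOwn v ↔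
          ∀ y, EdgeRel n m p e₁ e₂ v y → α ≤ y := by
  refine Runs.init_loop
    (fun s' => s'.var vM = m ∧ s'.arr aFst = e₁ ∧ s'.arr aSnd = e₂ ∧
      s'.arr aLeft = leftChild n p ∧ s'.var vI ≤ m ∧
      ∀ v, 1 ≤ v → v ≤ n → ∀ α, α ≤ s'.arr aOwn v ↔ α ≤ p v ∧
        ∀ i < s'.var vI, v = max (e₁ i) (e₂ i) → α ≤ min (e₁ i) (e₂ i))
    (fun s' => m - s'.var vI) rfl rfl ?_ ?_ ?_ ?_
  · simp (disch := omega) [Cmd.run, hm, h1, h2]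
    refine ⟨?_, fun v hv hvn α => by rw [ho v hv hvn]⟩
    funext v
    rw [Function.update_apply]
    split_ifs with h
    · rw [h]
      by_contra h0
      have := PreTree.par_leftChild (Ne.symm h0)
      omega
    · exact hl v (by omega)
  · simp (disch := omega) [Cmd.run]
    omega
  · rintro s' ⟨i1, i2, i3, i4, i5, i6⟩ ht
    simp (disch := omega) [i1] at ht
    -- one more edge: both cases update the entry of the upper end with the lower end
    have key : ∀ x y, x = max (e₁ (s'.var vI)) (e₂ (s'.var vI)) →
        y = min (e₁ (s'.var vI)) (e₂ (s'.var vI)) → ∀ v, 1 ≤ v → v ≤ n → ∀ α,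
        α ≤ Function.update (s'.arr aOwn) x (min (s'.arr aOwn x) y) v ↔ α ≤ p v ∧
        ∀ i < s'.var vI + 1, v = max (e₁ i) (e₂ i) → α ≤ min (e₁ i) (e₂ i) := by
      rintro x y hx hy v hv hvn α
      rw [Nat.forall_lt_succ_right, ← and_assoc, ← i6 v hv hvn α, Function.update_apply, ← hx,
        ← hy]
      split_ifs with h
      · subst h
        simp
      · simp [h]
    by_cases hlt : e₁ (s'.var vI) < e₂ (s'.var vI)
    · have := key _ _ (max_eq_right hlt.le).symm (min_eq_left hlt.le).symm
      simp (disch := omega) [Cmd.run, mod_small, i1, i2, i3, i4, hlt]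
      exact ⟨⟨ht, fun v hv hvn α => (this v hv hvn α).trans (by simp)⟩, by omega⟩
    · have := key _ _ (max_eq_left (not_lt.1 hlt)).symm (min_eq_right (not_lt.1 hlt)).symm
      simp (disch := omega) [Cmd.run, mod_small, i1, i2, i3, i4, hlt]
      exact ⟨⟨ht, fun v hv hvn α => (this v hv hvn α).trans (by simp)⟩, by omega⟩
  · rintro s' ⟨i1, i2, i3, i4, i5, i6⟩ ht
    simp (disch := omega) [i1] at ht
    have hi : s'.var vI = m := by omega
    refine ⟨i4, fun v hv hvn α => ?_⟩
    rw [i6 v hv hvn α, hi]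
    constructor
    · rintro ⟨h3, h4⟩ y (⟨-, -, rfl⟩ | ⟨i, hi, h5, rfl⟩)
      · exact h3
      · exact h4 i hi h5
    · intro h
      exact ⟨h _ (Or.inl ⟨hv, hvn, rfl⟩), fun i hi h5 => h _ (Or.inr ⟨i, hi, h5, rfl⟩)⟩

namespace PreTree

variable {n : ℕ} {p last : ℕ → ℕ} (T : PreTree n p last)
include T

theorem mem_subtree_iff {v x : ℕ} (hv : 1 ≤ v) (hvn : v ≤ n) :
    v ≤ x ∧ x ≤ last v ↔ x = v ∨ ∃ c, v < c ∧ c ≤ n ∧ p c = v ∧ c ≤ x ∧ x ≤ last c := by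
  constructor
  · rintro ⟨h1, h2⟩
    rcases h1.eq_or_lt with h1 | h1
    · exact Or.inl h1.symm
    · obtain ⟨c, hc1, hc2, hc3, hc4⟩ := T.exists_child hv hvn h1 h2
      have := T.last_le v hv hvn
      exact Or.inr ⟨c, hc1, by omega, hc4, hc2, hc3⟩
  · rintro (rfl | ⟨c, hc1, hc2, hc3, hc4, hc5⟩)
    · exact ⟨le_rfl, T.le_last x hv hvn⟩
    · have h1 := T.le_last_par (c := c) (by omega) (by omega) hc2
      rw [hc3] at h1
      have := T.last_mono hv hc1.le h1 hvn
      omega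

theorem mem_own_iff {v x : ℕ} (hl : leftChild n p v ≠ 0) :
    v ≤ x ∧ x < leftChild n p v ↔
      x = v ∨ ∃ c, v < c ∧ c ≤ n ∧ p c = v ∧ c ≠ leftChild n p v ∧ c ≤ x ∧ x ≤ last c := by
  have hv := (par_leftChild hl).1
  have hln := leftChild_le (n := n) (p := p) v
  have hvl := T.lt_leftChild hl
  have hll := T.last_leftChild hl
  have hlast := T.le_last _ (by omega) hln
  have hiff := T.mem_subtree_iff (x := x) hv (by omega)
  constructor
  · rintro ⟨h1, h2⟩
    rcases hiff.1 ⟨h1, by omega⟩ with h | ⟨c, hc1, hc2, hc3, hc4, hc5⟩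
    · exact Or.inl h
    · exact Or.inr ⟨c, hc1, hc2, hc3, by omega, hc4, hc5⟩
  · rintro (rfl | ⟨c, hc1, hc2, hc3, hc4, hc5, hc6⟩)
    · omega
    · have := T.last_lt_leftChild hv (by omega) hc2 hc3 hc4
      omega

theorem last_of_leaf {v : ℕ} (hv : 1 ≤ v) (hvn : v ≤ n) (hl : leftChild n p v = 0) :
    last v = v := by
  rcases (T.le_last v hv hvn).eq_or_lt with h | h
  · exact h.symm
  · obtain ⟨c, hc1, hc2, hc3, hc4⟩ := T.exists_child hv hvn h le_rfl
    have := le_leftChild (n := n) hv (hc2.trans (T.last_le v hv hvn)) hc4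
    omega

theorem mem_subtree_iff_own {v x : ℕ} (hv : 1 ≤ v) (hvn : v ≤ n) :
    v ≤ x ∧ x ≤ last v ↔
      (x = v ∨ ∃ c, v < c ∧ c ≤ n ∧ p c = v ∧ c ≠ leftChild n p v ∧ c ≤ x ∧ x ≤ last c) ∨
        leftChild n p v ≠ 0 ∧ leftChild n p v ≤ x ∧ x ≤ last (leftChild n p v) := by
  by_cases hl : leftChild n p v = 0
  · have := T.last_of_leaf hv hvn hl
    constructor
    · intro h
      exact Or.inl (Or.inl (by omega))
    · rintro ((rfl | ⟨c, hc1, hc2, hc3, _⟩) | ⟨h, _⟩)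
      · exact ⟨le_rfl, this.ge⟩
      · have := le_leftChild (n := n) hv hc2 hc3
        omega
      · exact absurd hl h
  · rw [← T.mem_own_iff hl]
    have hvl := T.lt_leftChild hl
    have hll := T.last_leftChild hl
    have hlast := T.le_last _ (by omega) (leftChild_le (n := n) (p := p) v)
    omega

end PreTree

/-- One round of `lowCmd`: completes the entries of the vertex `vI`, and passes on the least target
from its subtree to the parent, unless `vI` is the left child. -/
def lowBody : Cmd :=
  .write aLow (.var vI) (.get aOwn (.var vI)) ;;
  .branch (.get aLeft (.var vI))
    (.write aLow (.var vI)
      ((Expr.get aOwn (.var vI)).min (.get aLow (.get aLeft (.var vI))))) .nop ;;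
  .branch ((Expr.get aLeft (.get aPar (.var vI))).eq (.var vI)) .nop
    (.write aOwn (.get aPar (.var vI))
      ((Expr.get aOwn (.get aPar (.var vI))).min (.get aLow (.var vI)))) ;;
  .assign vI (.var vI - 1)

/-- Computes, from the leaves to the root, the least targets of the edges from a whole subtree, and
from a subtree without the subtree of the left child. -/
def lowCmd : Cmd :=
  .assign vI (.var vN) ;;
  .loop (.var vI)
    lowBody

theorem runs_lowCmd {w n L : ℕ} {p last : ℕ → ℕ} {E : ℕ → ℕ → Prop} (T : PreTree n p last)
    (hw : 100 * (n + 1) ≤ 2 ^ w) (hL : n < L) {s : State} (hn : s.var vN = n)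
    (hp : s.arr aPar = p) (hl : s.arr aLeft = leftChild n p)
    (ho : ∀ v, 1 ≤ v → v ≤ n → ∀ α, α ≤ s.arr aOwn v ↔ ∀ y, E v y → α ≤ y) :
    Runs w lowCmd s (L * lowCmd.time) fun s' =>
      PreTree.IsOwnLow n p E (s'.arr aOwn) ∧ PreTree.IsLow n last E (s'.arr aLow) := by
  refine Runs.init_loop
    (fun s' => s'.arr aPar = p ∧ s'.arr aLeft = leftChild n p ∧ s'.var vI ≤ n ∧
      (∀ v, 1 ≤ v → v ≤ n → ∀ α, α ≤ s'.arr aOwn v ↔ ∀ x y, E x y →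
        (x = v ∨ ∃ c, s'.var vI < c ∧ c ≤ n ∧ p c = v ∧ c ≠ leftChild n p v ∧
          c ≤ x ∧ x ≤ last c) → α ≤ y) ∧
      ∀ v, s'.var vI < v → v ≤ n → ∀ α, α ≤ s'.arr aLow v ↔
        ∀ x y, E x y → v ≤ x ∧ x ≤ last v → α ≤ y)
    (fun s' => s'.var vI) rfl rfl ?_ ?_ ?_ ?_
  · simp (disch := omega) [Cmd.run, hn, hp, hl]
    refine ⟨fun v hv hvn α => ?_, by omega⟩
    rw [ho v hv hvn]
    constructor
    · rintro h x y hE (rfl | ⟨c, hc1, hc2, _⟩)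
      · exact h y hE
      · omega
    · intro h y hE
      exact h v y hE (Or.inl rfl)
  · simp [Cmd.run, hn, hL]
  · rintro s' ⟨i1, i2, i3, i4, i5⟩ ht
    simp only [Expr.eval_var] at ht
    -- the new entry of `aLow`
    obtain ⟨low, hlow⟩ : ∃ low, low = if leftChild n p (s'.var vI) = 0 then s'.arr aOwn (s'.var vI)
      else min (s'.arr aOwn (s'.var vI)) (s'.arr aLow (leftChild n p (s'.var vI))) := ⟨_, rfl⟩
    have hpar := T.par_lt (s'.var vI) (by omega) i3
    have hlowspec : ∀ α, α ≤ low ↔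
        ∀ x y, E x y → s'.var vI ≤ x ∧ x ≤ last (s'.var vI) → α ≤ y := by
      intro α
      have hown := i4 (s'.var vI) (by omega) i3 α
      simp only [T.mem_subtree_iff_own (v := s'.var vI) (by omega) i3]
      by_cases hl0 : leftChild n p (s'.var vI) = 0
      · rw [hlow, if_pos hl0, hown]
        simp [hl0]
      · have h2 := i5 (leftChild n p (s'.var vI)) (T.lt_leftChild hl0) (PreTree.leftChild_le _) α
        rw [hlow, if_neg hl0, le_min_iff, hown, h2]
        constructor
        · rintro ⟨h3, h4⟩ x y hE (h5 | ⟨_, h5⟩)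
          · exact h3 x y hE h5
          · exact h4 x y hE h5
        · intro h
          exact ⟨fun x y hE h5 => h x y hE (Or.inl h5),
            fun x y hE h5 => h x y hE (Or.inr ⟨hl0, h5⟩)⟩
    -- the new array `aOwn`
    obtain ⟨own, hown⟩ : ∃ own, own = if leftChild n p (p (s'.var vI)) = s'.var vI then s'.arr aOwn
      else Function.update (s'.arr aOwn) (p (s'.var vI))
        (min (s'.arr aOwn (p (s'.var vI))) low) := ⟨_, rfl⟩
    have hrun : ∃ s'', s'' = lowBody.run w s' ∧
         s''.arr aPar = p ∧ s''.arr aLeft = leftChild n p ∧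
         s''.var vI = s'.var vI - 1 ∧ s''.arr aOwn = own ∧
         s''.arr aLow = Function.update (s'.arr aLow) (s'.var vI) low := by
      refine ⟨_, rfl, ?_⟩
      by_cases hl0 : leftChild n p (s'.var vI) = 0
      · by_cases hl1 : leftChild n p (p (s'.var vI)) = s'.var vI <;>
        simp (disch := omega) [lowBody, Cmd.run, mod_small, i1, i2, hl0, hl1, hown, hlow]
      · have hne := (T.lt_leftChild hl0).ne'
        by_cases hl1 : leftChild n p (p (s'.var vI)) = s'.var vI <;>
        simp (disch := omega) [lowBody, Cmd.run, mod_small, i1, i2, hl0, hl1, hown, hlow]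
    obtain ⟨s'', hs'', j1, j2, j3, j4, j5⟩ := hrun
    rw [← hs'']
    refine ⟨⟨j1, j2, by omega, ?_, ?_⟩, by omega⟩
    · intro v hv hvn α
      rw [j3, j4, hown]
      have hset : ∀ x, (∃ c, s'.var vI - 1 < c ∧ c ≤ n ∧ p c = v ∧ c ≠ leftChild n p v ∧
          c ≤ x ∧ x ≤ last c) ↔ (∃ c, s'.var vI < c ∧ c ≤ n ∧ p c = v ∧ c ≠ leftChild n p v ∧
          c ≤ x ∧ x ≤ last c) ∨ (p (s'.var vI) = v ∧ s'.var vI ≠ leftChild n p v) ∧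
            s'.var vI ≤ x ∧ x ≤ last (s'.var vI) := by
        intro x
        constructor
        · rintro ⟨c, hc, h1, h2, h3, h4⟩
          rcases (show s'.var vI ≤ c by omega).eq_or_lt with h | h
          · subst h
            exact Or.inr ⟨⟨h2, h3⟩, h4⟩
          · exact Or.inl ⟨c, h, h1, h2, h3, h4⟩
        · rintro (⟨c, hc, h⟩ | ⟨⟨h1, h2⟩, h3⟩)
          · exact ⟨c, by omega, h⟩
          · exact ⟨_, by omega, i3, h1, h2, h3⟩
      simp only [hset, ← or_assoc]
      by_cases hnew : p (s'.var vI) = v ∧ s'.var vI ≠ leftChild n p v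
      · obtain ⟨h1, h2⟩ := hnew
        subst h1
        rw [if_neg h2.symm, Function.update_self, le_min_iff, i4 _ hv hvn, hlowspec]
        simp only [true_and, ne_eq, h2, not_false_eq_true]
        constructor
        · rintro ⟨h3, h4⟩ x y hE (h5 | h5)
          · exact h3 x y hE h5
          · exact h4 x y hE h5
        · intro h
          exact ⟨fun x y hE h5 => h x y hE (Or.inl h5), fun x y hE h5 => h x y hE (Or.inr h5)⟩
      · simp only [hnew, false_and, or_false]
        rw [← i4 v hv hvn]
        split_ifs with h1
        · rfl
        · rw [Function.update_of_ne]
          rintro rfl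
          exact hnew ⟨rfl, fun h => h1 h.symm⟩
    · intro v hv hvn α
      rw [j5, Function.update_apply]
      split_ifs with h
      · rw [h, hlowspec]
      · exact i5 v (by omega) hvn α
  · rintro s' ⟨i1, i2, i3, i4, i5⟩ ht
    simp only [Expr.eval_var] at ht
    rw [ht] at i4 i5
    refine ⟨fun v hl α => ?_, fun v hv hvn α => ?_⟩
    · have hvl := T.lt_leftChild hl
      have hln := PreTree.leftChild_le (n := n) (p := p) v
      have hv := (PreTree.par_leftChild hl).1
      rw [i4 v hv (by omega)]
      have hset : ∀ x, (x = v ∨ ∃ c, 0 < c ∧ c ≤ n ∧ p c = v ∧ c ≠ leftChild n p v ∧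
          c ≤ x ∧ x ≤ last c) ↔ v ≤ x ∧ x < leftChild n p v := by
        intro x
        rw [T.mem_own_iff hl]
        refine or_congr_right (exists_congr fun c => and_congr_left fun h => ?_)
        have := fun h1 => T.par_lt c h1 h.1
        omega
      simp only [hset, and_imp]
    · rw [i5 v hv hvn]
      simp only [and_imp]

/-! ### Heads of leftmost paths -/

/-- Computes the top vertices of the maximal leftmost paths. -/
def headCmd : Cmd :=
  .assign vI 1 ;;
  .loop ((Expr.var vI).lt (.var vN + 1))
    (.branch ((Expr.get aLeft (.get aPar (.var vI))).eq (.var vI))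
       (.write aHead (.var vI) (.get aHead (.get aPar (.var vI))))
       (.write aHead (.var vI) (.var vI)) ;;
     .assign vI (.var vI + 1))

theorem runs_headCmd {w n L : ℕ} {p last : ℕ → ℕ} (T : PreTree n p last)
    (hw : 100 * (n + 1) ≤ 2 ^ w) (hL : n < L) {s : State} (hn : s.var vN = n)
    (hp : s.arr aPar = p) (hl : s.arr aLeft = leftChild n p) :
    Runs w headCmd s (L * headCmd.time) fun s' => PreTree.IsHead n last (s'.arr aHead) := by
  refine Runs.init_loop
    (fun s' => s'.var vN = n ∧ s'.arr aPar = p ∧ s'.arr aLeft = leftChild n p ∧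
      1 ≤ s'.var vI ∧ s'.var vI ≤ n + 1 ∧ ∀ v, 1 ≤ v → v < s'.var vI →
        1 ≤ s'.arr aHead v ∧ s'.arr aHead v ≤ v ∧ last (s'.arr aHead v) = last v ∧
          ∀ u, 1 ≤ u → u ≤ v → last u = last v → s'.arr aHead v ≤ u)
    (fun s' => n + 1 - s'.var vI) rfl rfl ?_ ?_ ?_ ?_
  · simp (disch := omega) [Cmd.run, mod_small, hn, hp, hl]
    omega
  · simp (disch := omega) [Cmd.run, mod_small]
    omega
  · rintro s' ⟨i1, i2, i3, i4, i5, i6⟩ ht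
    simp (disch := omega) [i1, mod_small] at ht
    have hpar := T.par_lt (s'.var vI) i4 (by omega)
    by_cases hl1 : leftChild n p (p (s'.var vI)) = s'.var vI
    · simp (disch := omega) [Cmd.run, mod_small, i1, i2, i3, hl1]
      refine ⟨⟨by omega, fun v hv hvi => ?_⟩, by omega⟩
      rcases (show v ≤ s'.var vI by omega).eq_or_lt with rfl | h
      · rw [Function.update_self]
        have hp1 := (PreTree.par_leftChild (n := n) (p := p) (v := p (s'.var vI)) (by omega)).1
        have hlast := (T.leftChild_par_iff (by omega) (by omega)).1 hl1
        obtain ⟨k1, k2, k3, k4⟩ := i6 (p (s'.var vI)) hp1 hpar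
        refine ⟨k1, by omega, by omega, fun u hu hui hul => ?_⟩
        rcases hui.eq_or_lt with rfl | hui
        · omega
        · exact k4 u hu (T.par_of_lt hu hui (by omega) hul).1 (by omega)
      · rw [Function.update_of_ne h.ne]
        exact i6 v hv h
    · simp (disch := omega) [Cmd.run, mod_small, i1, i2, i3, hl1]
      refine ⟨⟨by omega, fun v hv hvi => ?_⟩, by omega⟩
      rcases (show v ≤ s'.var vI by omega).eq_or_lt with rfl | h
      · rw [Function.update_self]
        refine ⟨hv, le_rfl, rfl, fun u hu hui hul => ?_⟩
        by_contra hcon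
        exact hl1 ((T.leftChild_par_iff (by omega) (by omega)).2
          (T.par_of_lt hu (by omega) (by omega) hul).2)
      · rw [Function.update_of_ne h.ne]
        exact i6 v hv h
  · rintro s' ⟨i1, i2, i3, i4, i5, i6⟩ ht
    simp (disch := omega) [i1, mod_small] at ht
    exact fun v hv hvn => i6 v hv (by omega)

/-! ### Stacks of valid vertices -/

/-- The number of vertices on the stack that starts with `u`. -/
noncomputable def stackDepth (n : ℕ) (p last : ℕ → ℕ) (E : ℕ → ℕ → Prop) (u : ℕ) : ℕ :=
  if h : u = 0 then 0 else
    have : nextValid n p last E u < u := PreTree.nextValid_lt h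
    stackDepth n p last E (nextValid n p last E u) + 1
termination_by u

theorem stackDepth_zero (n : ℕ) (p last : ℕ → ℕ) (E : ℕ → ℕ → Prop) :
    stackDepth n p last E 0 = 0 := by
  rw [stackDepth, dif_pos rfl]

theorem stackDepth_of_ne {n : ℕ} {p last : ℕ → ℕ} {E : ℕ → ℕ → Prop} {u : ℕ} (h : u ≠ 0) :
    stackDepth n p last E u = stackDepth n p last E (nextValid n p last E u) + 1 := by
  rw [stackDepth, dif_neg h]

/-- The left children greater than `v` of vertices less than `v`: their stacks are already known when
the vertex `v` is reached, but not yet used. -/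
def pending (n : ℕ) (p : ℕ → ℕ) (v : ℕ) : Finset ℕ :=
  {b ∈ Finset.range (n + 1) | v < b ∧ p b < v ∧ leftChild n p (p b) = b}

/-- The potential that bounds the number of remaining rounds of `nextCmd` when the vertex `v` has
been reached and `u` is on top of its stack. -/
noncomputable def potential (n : ℕ) (p last : ℕ → ℕ) (E : ℕ → ℕ → Prop) (v u : ℕ) : ℕ :=
  3 * (n + 1 - v) + stackDepth n p last E u + ∑ b ∈ pending n p v, stackDepth n p last E b

namespace PreTree

variable {n : ℕ} {p last : ℕ → ℕ} (T : PreTree n p last) {E : ℕ → ℕ → Prop}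
include T

omit T in
theorem potential_pop {v u : ℕ} (hu : u ≠ 0) :
    potential n p last E v (nextValid n p last E u) < potential n p last E v u := by
  rw [potential, potential, stackDepth_of_ne hu]
  omega

theorem potential_init : potential n p last E 1 1 = 3 * n + 1 := by
  have h : pending n p 1 = ∅ := by
    refine Finset.filter_eq_empty_iff.2 ?_
    rintro b hb ⟨h1, h2, h3⟩
    have := (par_leftChild (n := n) (p := p) (v := p b) (by omega)).1
    omega
  rw [potential, h, stackDepth_of_ne one_ne_zero, T.nextValid_eq_zero (Or.inl rfl),
    stackDepth_zero, Finset.sum_empty]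
  omega

/-- Moving on to the vertex `v + 1` decreases the potential: the stack of the left child of `v`, with
one element more than the current stack, becomes pending; the next stack was pending, or it is that of
a head and has one element; and the first summand pays `3` for this. -/
theorem potential_step {v u : ℕ} (hv : 1 ≤ v) (hvn : v ≤ n)
    (hu : leftChild n p v ≠ 0 → nextValid n p last E (leftChild n p v) = u) :
    potential n p last E (v + 1) (v + 1) < potential n p last E v u := by
  -- the stacks known after the step: those known before, and the one of the left child of `v`
  have hsub : pending n p (v + 1) ⊆ insert (leftChild n p v) (pending n p v) := by
    intro b hb
    simp only [pending, Finset.mem_filter, Finset.mem_insert] at hb ⊢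
    obtain ⟨h1, h2, h3, h4⟩ := hb
    rcases (show p b ≤ v by omega).eq_or_lt with h | h
    · rw [h] at h4
      exact Or.inl h4.symm
    · exact Or.inr ⟨h1, by omega, h, h4⟩
  have hdepth : stackDepth n p last E (leftChild n p v) ≤ stackDepth n p last E u + 1 := by
    by_cases h : leftChild n p v = 0
    · rw [h, stackDepth_zero]
      omega
    · rw [stackDepth_of_ne h, hu h]
  have hsum : ∑ b ∈ insert (leftChild n p v) (pending n p v), stackDepth n p last E b ≤
      stackDepth n p last E (leftChild n p v) +
        ∑ b ∈ pending n p v, stackDepth n p last E b := by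
    by_cases h : leftChild n p v ∈ pending n p v
    · rw [Finset.insert_eq_of_mem h]
      omega
    · rw [Finset.sum_insert h]
  have hmain : stackDepth n p last E (v + 1) +
      ∑ b ∈ pending n p (v + 1), stackDepth n p last E b ≤
      1 + ∑ b ∈ insert (leftChild n p v) (pending n p v), stackDepth n p last E b := by
    by_cases hc : v + 1 ≤ n ∧ leftChild n p (p (v + 1)) = v + 1
    · have hnot : v + 1 ∉ pending n p (v + 1) := by simp [pending]
      rw [← Finset.sum_insert hnot]
      refine le_add_left (Finset.sum_le_sum_of_subset (Finset.insert_subset ?_ hsub))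
      have := T.par_lt (v + 1) (by omega) hc.1
      rw [Finset.mem_insert]
      rcases (show p (v + 1) ≤ v by omega).eq_or_lt with h | h
      · rw [h] at hc
        exact Or.inl hc.2.symm
      · simp only [pending, Finset.mem_filter, Finset.mem_range]
        exact Or.inr ⟨by omega, by omega, h, hc.2⟩
    · have h0 : nextValid n p last E (v + 1) = 0 := by
        refine T.nextValid_eq_zero (Or.inr ?_)
        by_cases h : n < v + 1
        · exact Or.inl h
        · exact Or.inr fun h2 => hc ⟨by omega, h2⟩
      rw [stackDepth_of_ne (by omega : v + 1 ≠ 0), h0, stackDepth_zero]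
      have := Finset.sum_le_sum_of_subset (f := stackDepth n p last E) hsub
      omega
  rw [potential, potential]
  omega

end PreTree

/-- Computes `nextValid` by popping the stacks of valid vertices. -/
def nextCmd : Cmd :=
  (.assign vI 1 ;; .assign vJ 1) ;;
  .loop ((Expr.var vI).lt (.var vN + 1))
    (.branch ((Expr.get aOwn (.var vI)).lt (.get aPar (.var vJ)))
      (.assign vJ (.get aNext (.var vJ)))
      (.write aNext (.get aLeft (.var vI)) (.var vJ) ;;
       .assign vI (.var vI + 1) ;;
       .assign vJ (.var vI)))

theorem runs_nextCmd {w n L : ℕ} {p last own : ℕ → ℕ} {E : ℕ → ℕ → Prop}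
    (T : PreTree n p last) (hw : 100 * (n + 1) ≤ 2 ^ w) (hL : 3 * n + 1 < L)
    {s : State} (hn : s.var vN = n) (hp : s.arr aPar = p) (hl : s.arr aLeft = leftChild n p)
    (ho : s.arr aOwn = own) (hown : PreTree.IsOwnLow n p E own)
    (h0 : s.arr aNext = fun _ => 0) :
    Runs w nextCmd s (L * nextCmd.time) fun s' =>
      ∀ u, 1 ≤ u → u ≤ n → s'.arr aNext u = nextValid n p last E u := by
  refine Runs.init_loop
    (fun s' => s'.var vN = n ∧ s'.arr aPar = p ∧ s'.arr aLeft = leftChild n p ∧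
      s'.arr aOwn = own ∧ 1 ≤ s'.var vI ∧ s'.var vI ≤ n + 1 ∧
      PreTree.Candidate n p last E (s'.var vI) (s'.var vJ) ∧
      ∀ u, 1 ≤ u → u ≤ n → (p u < s'.var vI ∨ leftChild n p (p u) ≠ u) →
        s'.arr aNext u = nextValid n p last E u)
    (fun s' => potential n p last E (s'.var vI) (s'.var vJ)) rfl rfl ?_ ?_ ?_ ?_
  · simp (disch := omega) [Cmd.run, mod_small, hn, hp, hl, ho, h0]
    refine ⟨PreTree.candidate_self T le_rfl, fun u hu hun h => ?_⟩
    refine (T.nextValid_eq_zero ?_).symm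
    rcases h with h | h
    · have := fun h => T.par_pos u h hun
      omega
    · exact Or.inr (Or.inr h)
  · simp (disch := omega) [Cmd.run, mod_small, T.potential_init]
    omega
  · rintro s' ⟨i1, i2, i3, i4, i5, i6, i7, i8⟩ ht
    simp (disch := omega) [i1, mod_small] at ht
    by_cases hlt : own (s'.var vI) < p (s'.var vJ)
    · have hJ : s'.var vJ ≠ 0 := by
        intro h
        rw [h, T.par_zero] at hlt
        omega
      have hJ2 := i7.1.resolve_left hJ
      have hparJ := T.par_lt (s'.var vJ) hJ2.1 (by omega)
      have hnext := i8 (s'.var vJ) hJ2.1 (by omega) (Or.inl (by omega))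
      simp (disch := omega) [Cmd.run, i1, i2, i3, i4, hlt]
      rw [hnext]
      exact ⟨⟨i5, i6, PreTree.Candidate.pop T hown i7 hlt, i8⟩, PreTree.potential_pop hJ⟩
    · have hdone := PreTree.Candidate.done T hown i7 (not_lt.1 hlt)
      simp (disch := omega) [Cmd.run, mod_small, i1, i2, i3, i4, hlt]
      refine ⟨⟨by omega, PreTree.candidate_self T (by omega), fun u hu hun h => ?_⟩,
        T.potential_step i5 (by omega) hdone⟩
      rw [Function.update_apply]
      split_ifs with h1
      · rw [h1]
        exact (hdone (by omega)).symm
      · refine i8 u hu hun ?_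
        by_cases h2 : leftChild n p (p u) = u
        · refine Or.inl ?_
          by_contra hcon
          have : p u = s'.var vI := by
            rcases h with h | h
            · omega
            · exact absurd h2 h
          rw [this] at h2
          exact h1 h2.symm
        · exact Or.inr h2
  · rintro s' ⟨i1, i2, i3, i4, i5, i6, i7, i8⟩ ht
    simp (disch := omega) [i1, mod_small] at ht
    intro u hu hun
    have := T.par_lt u hu hun
    exact i8 u hu hun (Or.inl (by omega))

/-- Computes the values that enter the range minimum structure. -/
def valueCmd : Cmd :=
  .assign vI 1 ;;
  .loop ((Expr.var vI).lt (.var vN + 1))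
    (.branch (.get aNext (.var vI))
       (.write aVal (.var vI) (.get aPar (.get aNext (.var vI))))
       (.write aVal (.var vI) (.get aLow (.get aHead (.var vI)))) ;;
     .assign vI (.var vI + 1))

theorem runs_valueCmd {w n L : ℕ} {p last low hd : ℕ → ℕ} {E : ℕ → ℕ → Prop}
    (hw : 100 * (n + 1) ≤ 2 ^ w) (hL : n < L) {s : State} (hn : s.var vN = n)
    (hp : s.arr aPar = p) (hlow : s.arr aLow = low) (hhd : s.arr aHead = hd)
    (hnext : ∀ u, 1 ≤ u → u ≤ n → s.arr aNext u = nextValid n p last E u) :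
    Runs w valueCmd s (L * valueCmd.time) fun s' =>
      PreTree.IsValue n p last E low hd (s'.arr aVal) := by
  refine Runs.init_loop
    (fun s' => s'.var vN = n ∧ s'.arr aPar = p ∧ s'.arr aLow = low ∧ s'.arr aHead = hd ∧
      1 ≤ s'.var vI ∧ s'.var vI ≤ n + 1 ∧
      (∀ u, 1 ≤ u → u ≤ n → s'.arr aNext u = nextValid n p last E u) ∧
      ∀ x, 1 ≤ x → x < s'.var vI → s'.arr aVal x =
        if nextValid n p last E x = 0 then low (hd x) else p (nextValid n p last E x))
    (fun s' => n + 1 - s'.var vI) rfl rfl ?_ ?_ ?_ ?_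
  · simp (disch := omega) [Cmd.run, mod_small, hn, hp, hlow, hhd]
    exact ⟨hnext, by omega⟩
  · simp (disch := omega) [Cmd.run, mod_small]
    omega
  · rintro s' ⟨i1, i2, i3, i4, i5, i6, i7, i8⟩ ht
    simp (disch := omega) [i1, mod_small] at ht
    have hI := i7 (s'.var vI) i5 (by omega)
    by_cases hz : nextValid n p last E (s'.var vI) = 0 <;>
    · simp (disch := omega) [Cmd.run, mod_small, i1, i2, i3, i4, hI, hz]
      refine ⟨⟨by omega, i7, fun x hx hxI => ?_⟩, by omega⟩
      rw [Function.update_apply]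
      split_ifs with h1 h2 h2
      all_goals first
        | (subst h1; first | rfl | contradiction)
        | (rw [i8 x hx (by omega)]; simp [h2])
  · rintro s' ⟨i1, i2, i3, i4, i5, i6, i7, i8⟩ ht
    simp (disch := omega) [i1, mod_small] at ht
    exact fun x hx hxn => i8 x hx (by omega)

/-! ### Range minima inside a block -/

theorem isRangeMin_union {H : ℕ → ℕ} {i j i' j' m m' : ℕ} (h : IsRangeMin H i j m)
    (h' : IsRangeMin H i' j' m') (h1 : i ≤ i') (h2 : i' ≤ j + 1) (h3 : j ≤ j') :
    IsRangeMin H i j' (min m m') := by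
  intro α
  rw [le_min_iff, h α, h' α]
  constructor
  · rintro ⟨k1, k2⟩ x hx hxj
    rcases le_or_gt x j with h4 | h4
    · exact k1 x hx h4
    · exact k2 x (by omega) hxj
  · intro k
    exact ⟨fun x hx hxj => k x hx (by omega), fun x hx hxj => k x (by omega) hxj⟩

/-- Adding a power of two above `x` inserts an element into the set that `x` represents. -/
theorem testBit_two_pow_add {a x : ℕ} (hx : x < 2 ^ a) (k : ℕ) :
    (2 ^ a + x).testBit k = true ↔ k = a ∨ x.testBit k = true := by
  rcases lt_trichotomy k a with h | h | h
  · rw [Nat.testBit_two_pow_add_gt h]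
    simp [h.ne]
  · subst h
    rw [Nat.testBit_two_pow_add_eq, Nat.testBit_lt_two_pow hx]
    simp
  · have h1 : 2 ^ (a + 1) ≤ 2 ^ k := Nat.pow_le_pow_right (by norm_num) h
    rw [pow_succ] at h1
    rw [Nat.testBit_lt_two_pow (by omega), Nat.testBit_lt_two_pow (by omega)]
    simp [h.ne']

/-- `M` is the mask of the position `j` in its block of length `s`: the set, written in binary, of
the offsets of those positions up to `j` in the block of `j` whose `H`-values are at most all later
values up to `j`. -/
def IsMask (H : ℕ → ℕ) (s j M : ℕ) : Prop :=
  ∀ k, M.testBit k = true ↔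
    k ≤ j % s ∧ ∀ t, s * (j / s) + k < t → t ≤ j → H (s * (j / s) + k) ≤ H t

/-- The least position `≥ i` in the mask of `j` is the position of a minimum of `[i, j]`. -/
theorem IsMask.isRangeMin {H : ℕ → ℕ} {s i j M b : ℕ} (h : IsMask H s j M)
    (hblock : i / s = j / s) (hb : IsLowBit (M / 2 ^ (i % s)) b) :
    i + b ≤ j ∧ IsRangeMin H i j (H (i + b)) := by
  have hi := Nat.div_add_mod i s
  have hj := Nat.div_add_mod j s
  rw [hblock] at hi
  obtain ⟨hb1, hb2⟩ := hb
  simp only [Nat.testBit_div_two_pow] at hb1 hb2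
  obtain ⟨h1, h2⟩ := (h _).1 hb1
  have hib : s * (j / s) + (b + i % s) = i + b := by omega
  rw [hib] at h2
  have key : ∀ d t, j - t = d → i ≤ t → t ≤ j → H (i + b) ≤ H t := by
    intro d
    induction d using Nat.strong_induction_on with
    | _ d ih =>
      intro t hd hit htj
      rcases lt_trichotomy t (i + b) with h3 | h3 | h3
      · have h4 := hb2 (t - i) (by omega)
        have h5 : ¬ (t - i + i % s ≤ j % s ∧ ∀ t', s * (j / s) + (t - i + i % s) < t' →
            t' ≤ j → H (s * (j / s) + (t - i + i % s)) ≤ H t') := by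
          rw [← h]
          simp [h4]
        rw [show s * (j / s) + (t - i + i % s) = t by omega] at h5
        push Not at h5
        obtain ⟨t', k1, k2, k3⟩ := h5 (by omega)
        exact (ih (j - t') (by omega) t' rfl (by omega) k2).trans k3.le
      · rw [h3]
      · exact h2 t h3 htj
  refine ⟨by omega, fun α => ⟨fun hα x hx hxj => hα.trans (key _ x rfl hx hxj), fun hα => ?_⟩⟩
  exact hα _ (by omega) (by omega)

theorem IsMask.div_ne_zero {H : ℕ → ℕ} {s i j M : ℕ} (h : IsMask H s j M) (hij : i ≤ j)
    (hblock : i / s = j / s) : M / 2 ^ (i % s) ≠ 0 := by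
  have hi := Nat.div_add_mod i s
  have hj := Nat.div_add_mod j s
  rw [hblock] at hi
  have h1 : M.testBit (j % s) = true := (h _).2 ⟨le_rfl, fun t h1 h2 => by omega⟩
  have h2 := Nat.ge_two_pow_of_testBit h1
  have h3 : 2 ^ (i % s) ≤ 2 ^ (j % s) := Nat.pow_le_pow_right (by norm_num) (by omega)
  have := Nat.div_pos (h3.trans h2) (by positivity)
  omega

/-- What is known about the set `M` of offsets while offsets are being removed from the mask of the
previous position: it holds only offsets before `i` in the block that are minimal up to `i - 1`,
and all of those that are minimal up to `i`. -/
structure IsPreMask (H : ℕ → ℕ) (s i M : ℕ) : Prop where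
  sound : ∀ k, M.testBit k = true →
    k < i % s ∧ ∀ t, s * (i / s) + k < t → t < i → H (s * (i / s) + k) ≤ H t
  complete : ∀ k < i % s,
    (∀ t, s * (i / s) + k < t → t ≤ i → H (s * (i / s) + k) ≤ H t) → M.testBit k = true

namespace IsPreMask

variable {H : ℕ → ℕ} {s i M : ℕ}

theorem lt_two_pow (h : IsPreMask H s i M) : M < 2 ^ (i % s) := by
  refine Nat.lt_pow_two_of_testBit _ fun k hk => ?_
  by_contra hcon
  have := (h.sound k (by simpa using hcon)).1
  omega

theorem zero (H : ℕ → ℕ) {s i : ℕ} (hi : i % s = 0) : IsPreMask H s i 0 where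
  sound k hk := by simp at hk
  complete k hk := by omega

theorem testBit_log (hM : M ≠ 0) : M.testBit (Nat.log 2 M) = true := by
  have h1 := Nat.pow_log_le_self 2 hM
  have h2 := Nat.lt_pow_succ_log_self (b := 2) (by norm_num) M
  rw [pow_succ] at h2
  have := (testBit_two_pow_add (a := Nat.log 2 M) (x := M - 2 ^ Nat.log 2 M) (by omega)
    (Nat.log 2 M)).2 (Or.inl rfl)
  rwa [Nat.add_sub_cancel' h1] at this

theorem testBit_pop (hM : M ≠ 0) (k : ℕ) :
    (M.testBit k = true ↔ k = Nat.log 2 M ∨ (M - 2 ^ Nat.log 2 M).testBit k = true) ∧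
      (M - 2 ^ Nat.log 2 M).testBit (Nat.log 2 M) = false := by
  have h1 := Nat.pow_log_le_self 2 hM
  have h2 := Nat.lt_pow_succ_log_self (b := 2) (by norm_num) M
  rw [pow_succ] at h2
  have := testBit_two_pow_add (a := Nat.log 2 M) (x := M - 2 ^ Nat.log 2 M) (by omega) k
  rw [Nat.add_sub_cancel' h1] at this
  exact ⟨this, Nat.testBit_lt_two_pow (by omega)⟩

/-- The last offset is removed if its value is above the new one. -/
theorem pop (h : IsPreMask H s i M) (hM : M ≠ 0)
    (hlt : H i < H (s * (i / s) + Nat.log 2 M)) : IsPreMask H s i (M - 2 ^ Nat.log 2 M) where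
  sound k hk := h.sound k (((testBit_pop hM k).1).2 (Or.inr hk))
  complete k hk hmin := by
    refine (((testBit_pop hM k).1).1 (h.complete k hk hmin)).resolve_left ?_
    rintro rfl
    have := Nat.div_add_mod i s
    have := hmin i (by omega) le_rfl
    omega

/-- If the value of the last offset is not above the new one, then the same holds for all offsets,
because their values are not above that of the last one. -/
theorem push (h : IsPreMask H s i M)
    (hge : M ≠ 0 → H (s * (i / s) + Nat.log 2 M) ≤ H i) :
    IsMask H s i (M + 2 ^ (i % s)) := by
  have hi := Nat.div_add_mod i s
  intro k
  rw [Nat.add_comm, testBit_two_pow_add h.lt_two_pow]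
  constructor
  · rintro (rfl | hk)
    · exact ⟨le_rfl, fun t h1 h2 => by omega⟩
    · obtain ⟨h1, h2⟩ := h.sound k hk
      have hM : M ≠ 0 := by rintro rfl; simp at hk
      refine ⟨h1.le, fun t h3 h4 => ?_⟩
      rcases h4.eq_or_lt with rfl | h4
      · -- compare with the top of the stack
        have h5 := hge hM
        have h6 := (h.sound _ (testBit_log hM)).1
        have h7 : k ≤ Nat.log 2 M :=
          (Nat.le_log_iff_pow_le (by norm_num) hM).2 (Nat.ge_two_pow_of_testBit hk)
        rcases h7.eq_or_lt with h7 | h7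
        · rwa [h7]
        · exact (h2 _ (by omega) (by omega)).trans h5
      · exact h2 t h3 h4
  · rintro ⟨h1, h2⟩
    rcases h1.eq_or_lt with h1 | h1
    · exact Or.inl h1
    · exact Or.inr (h.complete k h1 h2)

end IsPreMask

theorem IsMask.isPreMask_succ {H : ℕ → ℕ} {s i M : ℕ} (h : IsMask H s i M)
    (hs : (i + 1) % s ≠ 0) : IsPreMask H s (i + 1) M := by
  have h1 : (i + 1) / s = i / s := by
    rw [Nat.succ_div, if_neg (fun hd => hs (Nat.mod_eq_zero_of_dvd hd)), Nat.add_zero]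
  have h2 := Nat.div_add_mod i s
  have h3 := Nat.div_add_mod (i + 1) s
  rw [h1] at h3
  constructor
  · intro k hk
    obtain ⟨k1, k2⟩ := (h k).1 hk
    rw [h1]
    exact ⟨by omega, fun t h4 h5 => k2 t h4 (by omega)⟩
  · intro k hk hmin
    rw [h1] at hmin
    exact (h k).2 ⟨by omega, fun t h4 h5 => hmin t h4 (by omega)⟩

/-- The number of elements of a set of offsets below `s`, written in binary. -/
def bitCount (s M : ℕ) : ℕ := ({k ∈ Finset.range s | M.testBit k = true} : Finset ℕ).card

theorem bitCount_pop {s M : ℕ} (hM : M ≠ 0) (hs : M < 2 ^ s) :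
    bitCount s (M - 2 ^ Nat.log 2 M) < bitCount s M := by
  refine Finset.card_lt_card ⟨fun k hk => ?_, fun hsub => ?_⟩
  · simp only [Finset.mem_filter] at hk ⊢
    exact ⟨hk.1, ((IsPreMask.testBit_pop hM k).1).2 (Or.inr hk.2)⟩
  · have := @hsub (Nat.log 2 M) (Finset.mem_filter.2 ⟨Finset.mem_range.2
      (Nat.log_lt_of_lt_pow hM hs), IsPreMask.testBit_log hM⟩)
    rw [Finset.mem_filter, (IsPreMask.testBit_pop hM 0).2] at this
    simp at this

theorem bitCount_push {s a M : ℕ} (hM : M < 2 ^ a) : bitCount s (M + 2 ^ a) ≤ bitCount s M + 1 := by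
  refine (Finset.card_le_card ?_).trans (Finset.card_insert_le a _)
  intro k hk
  simp only [Finset.mem_filter, Finset.mem_insert] at hk ⊢
  rw [Nat.add_comm, testBit_two_pow_add hM] at hk
  tauto

theorem bitCount_zero (s : ℕ) : bitCount s 0 = 0 := by
  simp [bitCount]

/-- One round of `maskCmd`: removes the last offset from the mask in `vJ` if its value is above that
of the position `vI`; otherwise adds the offset of `vI`, which completes the mask of `vI`. -/
def maskBody : Cmd :=
  .branch ((Expr.lt 0 (.var vJ)) * ((Expr.get aVal (.var vI)).lt
      (.get aVal (.var vI - .var vI % .var vSize + .get aLog (.var vJ)))))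
    (.assign vJ (.var vJ - .get aPow (.get aLog (.var vJ))))
    (.assign vJ (.var vJ + .get aPow (.var vI % .var vSize)) ;;
     .write aMask (.var vI) (.var vJ) ;;
     .assign vI (.var vI + 1) ;;
     .branch (.var vI % .var vSize) .nop (.assign vJ 0))

/-- Computes the masks of all positions. -/
def maskCmd : Cmd :=
  (.assign vBlocks (.var vN / .var vSize + 1) ;; .assign vI 0 ;; .assign vJ 0) ;;
  .loop ((Expr.var vI).lt (.var vBlocks * .var vSize))
    maskBody

theorem blocks_mul_le (n s : ℕ) : (n / s + 1) * s ≤ n + s := by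
  have := Nat.div_mul_le_self n s
  rw [Nat.add_mul]
  omega

theorem runs_maskCmd {w n L size : ℕ} {H : ℕ → ℕ} (hw : 100 * (n + 1) ≤ 2 ^ w)
    (hL : 6 * n < L) {s : State} (hn : s.var vN = n) (hsize : s.var vSize = size)
    (hs1 : 1 ≤ size) (hs : 2 ^ size ≤ 2 * n) (hH : s.arr aVal = H)
    (hpow : ∀ k < size, s.arr aPow k = 2 ^ k) (hlog : ∀ x < 2 ^ size, s.arr aLog x = Nat.log 2 x) :
    Runs w maskCmd s (L * maskCmd.time) fun s' => s'.var vBlocks = n / size + 1 ∧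
      ∀ j < (n / size + 1) * size, IsMask H size j (s'.arr aMask j) := by
  have hN := blocks_mul_le n size
  have hN2 : n / size ≤ n := Nat.div_le_self n size
  have hsn : size < 2 ^ size := Nat.lt_two_pow_self
  refine Runs.init_loop
    (fun s' => s'.var vSize = size ∧ s'.var vBlocks = n / size + 1 ∧ s'.arr aVal = H ∧
      s'.arr aPow = s.arr aPow ∧ s'.arr aLog = s.arr aLog ∧
      s'.var vI ≤ (n / size + 1) * size ∧ IsPreMask H size (s'.var vI) (s'.var vJ) ∧
      ∀ j < s'.var vI, IsMask H size j (s'.arr aMask j))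
    (fun s' => 2 * ((n / size + 1) * size - s'.var vI) + bitCount size (s'.var vJ))
    rfl rfl ?_ ?_ ?_ ?_
  · simp (disch := omega) [Cmd.run, mod_small, hn, hsize, hH]
    exact IsPreMask.zero H (Nat.zero_mod _)
  · simp (disch := omega) [Cmd.run, mod_small, hn, hsize, bitCount_zero]
    omega
  · rintro s' ⟨i1, i2, i3, i4, i5, i6, i7, i8⟩ ht
    simp (disch := omega) [i1, i2, mod_small] at ht
    have hdm := Nat.div_add_mod (s'.var vI) size
    have hst : s'.var vI - s'.var vI % size = size * (s'.var vI / size) := by omega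
    have hmod := Nat.mod_lt (s'.var vI) hs1
    have hJ := i7.lt_two_pow
    have hpowlt : 2 ^ (s'.var vI % size) < 2 ^ size :=
      Nat.pow_lt_pow_right (by norm_num) hmod
    have hlogJ := hlog (s'.var vJ) (by omega)
    have hlogle := Nat.log_le_self 2 (s'.var vJ)
    by_cases hpop : 0 < s'.var vJ ∧
        H (s'.var vI) < H (size * (s'.var vI / size) + Nat.log 2 (s'.var vJ))
    · have hpowJ := hpow (Nat.log 2 (s'.var vJ)) (Nat.log_lt_of_lt_pow (by omega) (by omega))
      simp (disch := omega) [maskBody, Cmd.run, mod_small, i1, i2, i3, i4, i5, hlogJ, hst, hpop, hpowJ]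
      exact ⟨⟨i6, i7.pop (by omega) hpop.2, i8⟩, bitCount_pop (by omega) (by omega)⟩
    · have hpowI := hpow _ hmod
      have hmask := i7.push (fun h => not_lt.1 fun h2 => hpop ⟨by omega, h2⟩)
      have hcount := bitCount_push (s := size) hJ
      have hmasks : ∀ j < s'.var vI + 1, IsMask H size j (Function.update (s'.arr aMask)
          (s'.var vI) (s'.var vJ + 2 ^ (s'.var vI % size)) j) := by
        intro j hj
        rw [Function.update_apply]
        split_ifs with h
        · rw [h]; exact hmask
        · exact i8 j (by omega)
      have htest : ((if 0 < s'.var vJ then 1 else 0) * if H (s'.var vI) <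
          H (size * (s'.var vI / size) + Nat.log 2 (s'.var vJ)) then 1 else 0) = 0 := by
        rw [not_and_or] at hpop
        rcases hpop with h | h <;> simp [h]
      have hrun : ∃ s'', s'' = maskBody.run w s' ∧
          s''.var vSize = size ∧ s''.var vBlocks = n / size + 1 ∧ s''.arr aVal = H ∧
          s''.arr aPow = s.arr aPow ∧ s''.arr aLog = s.arr aLog ∧
          s''.var vI = s'.var vI + 1 ∧
          s''.var vJ = (if (s'.var vI + 1) % size ≠ 0 then
            s'.var vJ + 2 ^ (s'.var vI % size) else 0) ∧
          s''.arr aMask = Function.update (s'.arr aMask) (s'.var vI)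
            (s'.var vJ + 2 ^ (s'.var vI % size)) := by
        refine ⟨_, rfl, ?_⟩
        by_cases hz : (s'.var vI + 1) % size = 0 <;>
        simp (disch := omega) [maskBody, Cmd.run, mod_small, i1, i2, i3, i4, i5, hlogJ, hst, hpowI, hz,
          htest]
      obtain ⟨s'', hs'', j1, j2, j3, j4, j5, j6, j7, j8⟩ := hrun
      rw [← hs'']
      refine ⟨⟨j1, j2, j3, j4, j5, by omega, ?_, by rwa [j6, j8]⟩, ?_⟩
      · rw [j6, j7]
        split_ifs with hz
        · exact hmask.isPreMask_succ hz
        · exact IsPreMask.zero H (not_not.1 hz)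
      · rw [j6, j7]
        split_ifs with hz
        · omega
        · rw [bitCount_zero]
          omega
  · rintro s' ⟨i1, i2, i3, i4, i5, i6, i7, i8⟩ ht
    simp (disch := omega) [i1, i2, mod_small] at ht
    exact ⟨i2, fun j hj => i8 j (by omega)⟩

/-- The minimum of the array `aVal` on `[i, j]`, if this range lies in one block. -/
def blockMin (i j : Expr) : Expr :=
  .get aVal (i + .get aBit (.get aMask j / .get aPow (i % .var vSize)))

/-- The tables for range minima inside the blocks are present in the memory. There are
`n / size + 1` blocks of length `size`. -/
structure BlockTables (n size : ℕ) (H : ℕ → ℕ) (s : State) : Prop where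
  size_pos : 1 ≤ size
  lt_pow : n < 2 ^ size
  pow_le : 2 ^ size ≤ 2 * n
  size_eq : s.var vSize = size
  blocks : s.var vBlocks = n / size + 1
  val : s.arr aVal = H
  pow : ∀ k < size, s.arr aPow k = 2 ^ k
  log : ∀ x < 2 ^ size, s.arr aLog x = Nat.log 2 x
  bit : ∀ x, 1 ≤ x → x < 2 ^ size → IsLowBit x (s.arr aBit x)
  mask : ∀ j < (n / size + 1) * size, IsMask H size j (s.arr aMask j)

theorem BlockTables.congr {n size : ℕ} {H : ℕ → ℕ} {s s' : State} (h : BlockTables n size H s)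
    (h1 : s'.var vSize = s.var vSize) (h2 : s'.var vBlocks = s.var vBlocks)
    (h3 : s'.arr aVal = s.arr aVal) (h4 : s'.arr aPow = s.arr aPow)
    (h5 : s'.arr aLog = s.arr aLog) (h6 : s'.arr aBit = s.arr aBit)
    (h7 : s'.arr aMask = s.arr aMask) : BlockTables n size H s' := by
  refine ⟨h.size_pos, h.lt_pow, h.pow_le, h1.trans h.size_eq, h2.trans h.blocks,
    h3.trans h.val, ?_, ?_, ?_, ?_⟩
  · rw [h4]; exact h.pow
  · rw [h5]; exact h.log
  · rw [h6]; exact h.bit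
  · rw [h7]; exact h.mask

theorem IsMask.lt_two_pow {H : ℕ → ℕ} {s j M : ℕ} (h : IsMask H s j M) (hs : 1 ≤ s) :
    M < 2 ^ s := by
  refine Nat.lt_pow_two_of_testBit _ fun k hk => ?_
  by_contra hcon
  have := ((h k).1 (by simpa using hcon)).1
  have := Nat.mod_lt j hs
  omega

theorem BlockTables.blockMin {w n size : ℕ} {H : ℕ → ℕ} {s : State}
    (h : BlockTables n size H s) (hw : 100 * (n + 1) ≤ 2 ^ w) {e₁ e₂ : Expr} {i j : ℕ}
    (h1 : e₁.eval w s = i) (h2 : e₂.eval w s = j) (hij : i ≤ j)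
    (hblock : i / size = j / size) (hj : j < (n / size + 1) * size) :
    IsRangeMin H i j ((blockMin e₁ e₂).eval w s) := by
  have hmask := h.mask j hj
  have hlt := hmask.lt_two_pow h.size_pos
  have hne := hmask.div_ne_zero hij hblock
  have hbit := h.bit (s.arr aMask j / 2 ^ (i % size)) (Nat.one_le_iff_ne_zero.2 hne)
    ((Nat.div_le_self _ _).trans_lt hlt)
  have hpow := h.pow _ (Nat.mod_lt i h.size_pos)
  obtain ⟨k1, k2⟩ := hmask.isRangeMin hblock hbit
  have hN := blocks_mul_le n size
  have hsn : size < 2 ^ size := Nat.lt_two_pow_self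
  have hle := h.pow_le
  simp only [StabQuery.blockMin, Expr.eval_get, Expr.eval_add, Expr.eval_div, Expr.eval_mod,
    Expr.eval_var, h1, h2, h.size_eq, hpow, h.val]
  rwa [mod_small (by omega)]

/-! ### Range minima over blocks -/

/-- `mins` is the table of the minima over all sequences of `2 ^ k` consecutive blocks (there are
`N` blocks, and the one that starts with block `q` has the index `k * N + q`). -/
def IsSparseTable (H : ℕ → ℕ) (size N : ℕ) (mins : ℕ → ℕ) : Prop :=
  ∀ k q, k < size → q + 2 ^ k ≤ N →
    IsRangeMin H (size * q) (size * (q + 2 ^ k) - 1) (mins (k * N + q))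

/-- One round of `minCmd`: a single block, or the union of two sequences of half the length. -/
def minBody : Cmd :=
  .branch ((Expr.var vI).lt (.var vBlocks))
    (.write aMin (.var vI) (blockMin (.var vI * .var vSize)
      (.var vI * .var vSize + (.var vSize - 1))))
    (.write aMin (.var vI) ((Expr.get aMin (.var vI - .var vBlocks)).min
      (.get aMin (.var vI - .var vBlocks + .get aPow (.var vI / .var vBlocks - 1))))) ;;
  .assign vI (.var vI + 1)

/-- Computes the minima over all sequences of consecutive blocks whose number is a power of two. -/
def minCmd : Cmd :=
  .assign vI 0 ;;
  .loop ((Expr.var vI).lt (.var vSize * .var vBlocks))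
    minBody

theorem runs_minCmd {w n L size : ℕ} {H : ℕ → ℕ} (hw : 100 * (n + 1) ≤ 2 ^ w)
    (hL : 3 * n < L) {s : State} (h : BlockTables n size H s) :
    Runs w minCmd s (L * minCmd.time) fun s' =>
      IsSparseTable H size (n / size + 1) (s'.arr aMin) := by
  obtain ⟨N, hNdef⟩ : ∃ N, N = n / size + 1 := ⟨_, rfl⟩
  have hN := blocks_mul_le n size
  have hN2 : n / size ≤ n := Nat.div_le_self n size
  have hsn : size < 2 ^ size := Nat.lt_two_pow_self
  have hle := h.pow_le
  have hsize := h.size_pos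
  have hcomm := Nat.mul_comm N size
  have hblocks := h.blocks
  rw [← hNdef] at hN hblocks ⊢
  refine Runs.init_loop
    (fun s' => BlockTables n size H s' ∧ s'.var vI ≤ size * N ∧
      ∀ k q, k * N + q < s'.var vI → q + 2 ^ k ≤ N →
        IsRangeMin H (size * q) (size * (q + 2 ^ k) - 1) (s'.arr aMin (k * N + q)))
    (fun s' => size * N - s'.var vI) rfl rfl ?_ ?_ ?_ ?_
  · simp [Cmd.run]
    exact h.congr rfl rfl rfl rfl rfl rfl rfl
  · simp [Cmd.run]
    omega
  · rintro s' ⟨i1, i2, i3⟩ ht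
    have hsize' := i1.size_eq
    have hblocks' := i1.blocks
    rw [← hNdef] at hblocks'
    simp (disch := omega) [hsize', hblocks', mod_small] at ht
    have hk : s'.var vI / N < size := Nat.div_lt_of_lt_mul (by omega)
    have hdm := Nat.div_add_mod (s'.var vI) N
    -- the new entry
    obtain ⟨v, hv⟩ : ∃ v, v = if s'.var vI < N then
        (blockMin (.var vI * .var vSize) (.var vI * .var vSize + (.var vSize - 1))).eval w s'
      else min (s'.arr aMin (s'.var vI - N))
        (s'.arr aMin (s'.var vI - N + 2 ^ (s'.var vI / N - 1))) := ⟨_, rfl⟩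
    have hspec : ∀ k q, k * N + q = s'.var vI → q + 2 ^ k ≤ N →
        IsRangeMin H (size * q) (size * (q + 2 ^ k) - 1) v := by
      intro k q hkq hq
      have hkpos : 0 < 2 ^ k := by positivity
      rcases Nat.eq_zero_or_pos k with rfl | hkp
      · have hI : s'.var vI = q := by omega
        rw [hv, if_pos (by omega), pow_zero]
        have hqs : q * size + size ≤ N * size := by
          have := Nat.mul_le_mul_right size (show q + 1 ≤ N by omega)
          rwa [Nat.add_mul, Nat.one_mul] at this
        have heq : size * (q + 1) - 1 = q * size + (size - 1) := by
          rw [Nat.mul_add, Nat.mul_comm size q]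
          omega
        rw [heq, Nat.mul_comm size q]
        refine i1.blockMin hw ?_ ?_ (by omega) ?_ (by rw [← hNdef]; omega)
        · simp (disch := omega) [hI, hsize', mod_small]
        · simp (disch := omega) [hI, hsize', mod_small]
        · rw [Nat.mul_div_cancel _ hsize, Nat.mul_comm q size, Nat.mul_add_div hsize,
            Nat.div_eq_of_lt (show size - 1 < size by omega), Nat.add_zero]
      · obtain ⟨k, rfl⟩ : ∃ k', k = k' + 1 := ⟨k - 1, by omega⟩
        have hpow : 2 ^ (k + 1) = 2 ^ k + 2 ^ k := by rw [pow_succ]; omega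
        have h2k : 0 < 2 ^ k := by positivity
        rw [Nat.add_mul, Nat.one_mul] at hkq
        have hdiv : s'.var vI / N = k + 1 := by
          rw [← hkq, show k * N + N + q = N * (k + 1) + q by ring, Nat.mul_add_div (by omega),
            Nat.div_eq_of_lt (by omega), Nat.add_zero]
        rw [hv, if_neg (by omega), hdiv, Nat.add_sub_cancel,
          show s'.var vI - N = k * N + q by omega, Nat.add_assoc]
        have r1 := i3 k q (by omega) (by omega)
        have r2 := i3 k (q + 2 ^ k) (by omega) (by omega)
        rw [Nat.add_assoc, ← hpow] at r2
        have m1 : size * q ≤ size * (q + 2 ^ k) := Nat.mul_le_mul_left _ (by omega)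
        have m2 : size * (q + 2 ^ k) ≤ size * (q + 2 ^ (k + 1)) :=
          Nat.mul_le_mul_left _ (by omega)
        exact isRangeMin_union r1 r2 m1 (by omega) (by omega)
    have hrun : ∃ s'', s'' = minBody.run w s' ∧
        s'' = (s'.setArr aMin (s'.var vI) v).setVar vI (s'.var vI + 1) := by
      refine ⟨_, rfl, ?_⟩
      by_cases hlt : s'.var vI < N
      · rw [if_pos hlt] at hv
        simp (disch := omega) [minBody, Cmd.run, mod_small, hblocks', hlt, ← hv]
      · rw [if_neg hlt] at hv
        have hpow := i1.pow (s'.var vI / N - 1) (by omega)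
        have hpow2 : 2 ^ (s'.var vI / N - 1) ≤ 2 ^ size :=
          Nat.pow_le_pow_right (by norm_num) (by omega)
        simp (disch := omega) [minBody, Cmd.run, mod_small, hblocks', hlt, ← hv, hpow]
    obtain ⟨s'', hs'', hrun⟩ := hrun
    rw [← hs'', hrun]
    simp only [State.setVar_var, State.setVar_arr, State.setArr_arr, if_true]
    refine ⟨⟨i1.congr rfl rfl rfl rfl rfl rfl rfl, by omega, fun k q hkq hq => ?_⟩, by omega⟩
    rw [Function.update_apply]
    split_ifs with heq
    · exact hspec k q heq hq
    · exact i3 k q (by omega) hq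
  · rintro s' ⟨i1, i2, i3⟩ ht
    have hsize' := i1.size_eq
    have hblocks' := i1.blocks
    rw [← hNdef] at hblocks'
    simp (disch := omega) [hsize', hblocks', mod_small] at ht
    intro k q hk hq
    refine i3 k q ?_ hq
    have := Nat.mul_le_mul_right N (show k + 1 ≤ size by omega)
    have : 0 < 2 ^ k := by positivity
    rw [Nat.add_mul] at *
    omega

/-- Finds the minimum of the range from `vJ` to `vB`. -/
def rangeCmd : Cmd :=
  .assign vK (.var vJ / .var vSize) ;;
  .assign vL (.var vB / .var vSize) ;;
  .branch ((Expr.var vK).eq (.var vL))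
    (.assign vP (blockMin (.var vJ) (.var vB)))
    (.assign vP ((blockMin (.var vJ) (.var vK * .var vSize + (.var vSize - 1))).min
       (blockMin (.var vL * .var vSize) (.var vB))) ;;
     .branch ((Expr.var vK + 1).lt (.var vL))
       (.assign vQ (.get aLog (.var vL - .var vK - 1)) ;;
        .assign vP ((Expr.var vP).min
          ((Expr.get aMin (.var vQ * .var vBlocks + (.var vK + 1))).min
            (.get aMin (.var vQ * .var vBlocks + (.var vL - .get aPow (.var vQ)))))))
       .nop)

theorem run_rangeCmd {w n size i j : ℕ} {H : ℕ → ℕ} (hw : 100 * (n + 1) ≤ 2 ^ w) {s : State}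
    (h : BlockTables n size H s) (hmin : IsSparseTable H size (n / size + 1) (s.arr aMin))
    (hi : s.var vJ = i) (hj : s.var vB = j) (hij : i ≤ j) (hjn : j ≤ n) :
    IsRangeMin H i j ((rangeCmd.run w s).var vP) ∧ (rangeCmd.run w s).var vI = s.var vI := by
  obtain ⟨N, hNdef⟩ : ∃ N, N = n / size + 1 := ⟨_, rfl⟩
  have hN := blocks_mul_le n size
  have hN2 : n / size ≤ n := Nat.div_le_self n size
  have hsn : size < 2 ^ size := Nat.lt_two_pow_self
  have hle := h.pow_le
  have hlt := h.lt_pow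
  have hsize := h.size_pos
  have hsize' := h.size_eq
  have hcomm := Nat.mul_comm N size
  have hblocks := h.blocks
  rw [← hNdef] at hN hblocks hmin
  have hbi : 0 ≤ i / size := Nat.zero_le _
  have hbij : i / size ≤ j / size := Nat.div_le_div_right hij
  have hbj : j / size ≤ n / size := Nat.div_le_div_right hjn
  have hdi := Nat.div_add_mod i size
  have hdj := Nat.div_add_mod j size
  have hmi := Nat.mod_lt i hsize
  have hmj := Nat.mod_lt j hsize
  have hjN : j < N * size := by
    have : size * (j / size + 1) ≤ size * N := Nat.mul_le_mul_left _ (by omega)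
    rw [Nat.mul_add] at this
    omega
  have hci := Nat.mul_comm (i / size) size
  have hcj := Nat.mul_comm (j / size) size
  by_cases hblock : i / size = j / size
  · have := (h.congr (s' := (s.setVar vK (j / size)).setVar vL (j / size))
      rfl rfl rfl rfl rfl rfl rfl).blockMin hw
      (e₁ := .var vJ) (e₂ := .var vB) hi hj hij hblock (by rwa [← hNdef])
    simpa [rangeCmd, Cmd.run, hi, hj, hsize', hblock] using this
  · -- the state after the two block numbers have been computed
    obtain ⟨s₁, hs₁⟩ : ∃ s₁, s₁ = (s.setVar vK (i / size)).setVar vL (j / size) := ⟨_, rfl⟩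
    have t₁ : BlockTables n size H s₁ := by
      rw [hs₁]
      exact h.congr rfl rfl rfl rfl rfl rfl rfl
    have hmul : size * (i / size + 1) ≤ size * (j / size) := Nat.mul_le_mul_left _ (by omega)
    rw [Nat.mul_add, Nat.mul_one] at hmul
    obtain ⟨m₁, hm₁⟩ : ∃ m, m = (blockMin (.var vJ)
      (.var vK * .var vSize + (.var vSize - 1))).eval w s₁ := ⟨_, rfl⟩
    obtain ⟨m₂, hm₂⟩ : ∃ m, m = (blockMin (.var vL * .var vSize) (.var vB)).eval w s₁ := ⟨_, rfl⟩
    have r₁ : IsRangeMin H i (i / size * size + (size - 1)) m₁ := by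
      rw [hm₁]
      refine t₁.blockMin hw ?_ ?_ (by omega) ?_ (by rw [← hNdef]; omega)
      · simp [hs₁, hi]
      · simp (disch := omega) [hs₁, hsize', mod_small]
      · rw [hci, Nat.mul_add_div hsize, Nat.div_eq_of_lt (show size - 1 < size by omega),
          Nat.add_zero]
    have r₂ : IsRangeMin H (j / size * size) j m₂ := by
      rw [hm₂]
      refine t₁.blockMin hw ?_ ?_ (by omega) ?_ (by rw [← hNdef]; omega)
      · simp (disch := omega) [hs₁, hsize', mod_small]
      · simp [hs₁, hj]
      · rw [Nat.mul_div_cancel _ hsize]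
    have hbl1 := hm₁.symm
    have hbl2 := hm₂.symm
    rw [hs₁] at hbl1 hbl2
    by_cases hadj : i / size + 1 < j / size
    · obtain ⟨len, hlen⟩ : ∃ len, len = j / size - i / size - 1 := ⟨_, rfl⟩
      have hk1 := Nat.pow_log_le_self 2 (show len ≠ 0 by omega)
      have hk2 := Nat.lt_pow_succ_log_self (b := 2) (by norm_num) len
      rw [pow_succ] at hk2
      have hk3 : Nat.log 2 len < size := Nat.log_lt_of_lt_pow (by omega) (by omega)
      have hlog := h.log len (by omega)
      have hpow := h.pow _ hk3
      have hkN : Nat.log 2 len * N ≤ size * N := Nat.mul_le_mul_right _ hk3.le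
      have q₁ := hmin (Nat.log 2 len) (i / size + 1) hk3 (by omega)
      have q₂ := hmin (Nat.log 2 len) (j / size - 2 ^ Nat.log 2 len) hk3 (by omega)
      rw [Nat.sub_add_cancel (by omega)] at q₂
      have m1 : size * (i / size + 1) ≤ size * (j / size - 2 ^ Nat.log 2 len) :=
        Nat.mul_le_mul_left _ (by omega)
      have m2 : size * (j / size - 2 ^ Nat.log 2 len) ≤
          size * (i / size + 1 + 2 ^ Nat.log 2 len) := Nat.mul_le_mul_left _ (by omega)
      have m3 : size * (i / size + 1 + 2 ^ Nat.log 2 len) ≤ size * (j / size) :=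
        Nat.mul_le_mul_left _ (by omega)
      have m4 : size * (i / size + 1) = size * (i / size) + size := by rw [Nat.mul_add]; omega
      -- two overlapping table entries cover the blocks strictly between those of `i` and `j`
      have q := isRangeMin_union q₁ q₂ m1 (by omega) (by omega)
      have q' := isRangeMin_union r₁ q (by omega) (by omega) (by omega)
      have q'' := isRangeMin_union q' r₂ (by omega) (by omega) (by omega)
      rw [min_right_comm] at q''
      simp (disch := omega) [rangeCmd, Cmd.run, mod_small, hi, hj, hsize', hblock, hadj, hbl1,
        hbl2, ← hlen, hlog, hpow, hblocks]
      simpa using q''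
    · have q := isRangeMin_union r₁ r₂ (by omega) (by
        have : j / size = i / size + 1 := by omega
        rw [this, Nat.add_mul]
        omega) (by omega)
      simp (disch := omega) [rangeCmd, Cmd.run, mod_small, hi, hj, hsize', hblock, hadj, hbl1,
        hbl2]
      simpa using q

/-! ### Preprocessing and queries -/

/-- The preprocessing. -/
def preCmd : Cmd :=
  powCmd ;; tableCmd ;; leftCmd ;; ownCmd ;; lowCmd ;; headCmd ;; nextCmd ;; valueCmd ;;
    maskCmd ;; minCmd

/-- Everything that a query needs is present in the memory. -/
structure Prepared (n : ℕ) (p last : ℕ → ℕ) (E : ℕ → ℕ → Prop) (s : State) : Prop where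
  par : s.arr aPar = p
  left : s.arr aLeft = leftChild n p
  head : PreTree.IsHead n last (s.arr aHead)
  low : ∃ low, PreTree.IsLow n last E low ∧ PreTree.IsValue n p last E low (s.arr aHead) (s.arr aVal)
  tables : ∃ size, BlockTables n size (s.arr aVal) s ∧
    IsSparseTable (s.arr aVal) size (n / size + 1) (s.arr aMin)

theorem Prepared.congr {n : ℕ} {p last : ℕ → ℕ} {E : ℕ → ℕ → Prop} {s s' : State}
    (h : Prepared n p last E s) (ha : ∀ k, s'.arr k = s.arr k)
    (h1 : s'.var vSize = s.var vSize) (h2 : s'.var vBlocks = s.var vBlocks) :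
    Prepared n p last E s' := by
  obtain ⟨k1, k2, k3, k4, size, k5, k6⟩ := h
  refine ⟨by rw [ha, k1], by rw [ha, k2], by rwa [ha], by simpa only [ha] using k4, size, ?_, ?_⟩
  · rw [ha]
    exact k5.congr h1 h2 (ha _) (ha _) (ha _) (ha _) (ha _)
  · rwa [ha, ha]

theorem runs_preCmd {w n m : ℕ} {p last : ℕ → ℕ} (T : PreTree n p last) (hn1 : 1 ≤ n)
    (hw : 100 * (n + m + 1) ≤ 2 ^ w) {s : State} (hn : s.var vN = n) (hm : s.var vM = m)
    (hp : s.arr aPar = p) (h0 : ∀ k, 3 ≤ k → s.arr k = fun _ => 0) :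
    Runs w preCmd s (20 * (n + m) * preCmd.time)
      (Prepared n p last (EdgeRel n m p (s.arr aFst) (s.arr aSnd))) := by
  have hw' : 100 * (n + 1) ≤ 2 ^ w := by omega
  obtain ⟨L, hL⟩ : ∃ L, L = 20 * (n + m) := ⟨_, rfl⟩
  rw [← hL]
  have htime : L * preCmd.time = L * powCmd.time + (L * tableCmd.time + (L * leftCmd.time +
      (L * ownCmd.time + (L * lowCmd.time + (L * headCmd.time + (L * nextCmd.time +
      (L * valueCmd.time + (L * maskCmd.time + L * minCmd.time)))))))) := by
    simp only [preCmd, Cmd.time, Nat.mul_add]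
  rw [htime]
  refine Runs.seq (runs_powCmd hw' hn1 (by omega) hn).frame ?_
  rintro s₁ ⟨⟨a1, a2, a3, a4⟩, va, aa⟩
  refine Runs.seq (runs_tableCmd (top := 2 ^ s₁.var vSize) (by omega) (by omega) (by omega) a1
    (by rw [aa _ rfl, h0 _ (by omega)]) (by rw [aa _ rfl, h0 _ (by omega)])).frame ?_
  rintro s₂ ⟨⟨b1, b2⟩, vb, ab⟩
  refine Runs.seq (runs_leftCmd (p := p) hw' (by omega) (by rw [vb _ rfl, va _ rfl, hn])
    (by rw [ab _ rfl, aa _ rfl, hp])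
    (by rw [ab _ rfl, aa _ rfl, h0 _ (by omega)])).frame ?_
  rintro s₃ ⟨⟨c1, c2⟩, vc, ac⟩
  refine Runs.seq (runs_ownCmd (e₁ := s.arr aFst) (e₂ := s.arr aSnd) hw (by omega)
    (by rw [vc _ rfl, vb _ rfl, va _ rfl, hm])
    (by rw [ac _ rfl, ab _ rfl, aa _ rfl]) (by rw [ac _ rfl, ab _ rfl, aa _ rfl]) c1 c2).frame ?_
  rintro s₄ ⟨⟨d1, d2⟩, vd, ad⟩
  have n4 : s₄.var vN = n := by rw [vd _ rfl, vc _ rfl, vb _ rfl, va _ rfl, hn]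
  have p4 : s₄.arr aPar = p := by rw [ad _ rfl, ac _ rfl, ab _ rfl, aa _ rfl, hp]
  refine Runs.seq (runs_lowCmd T hw' (by omega) n4 p4 d1 d2).frame ?_
  rintro s₅ ⟨⟨e1, e2⟩, ve, ae⟩
  have n5 : s₅.var vN = n := by rw [ve _ rfl, n4]
  have p5 : s₅.arr aPar = p := by rw [ae _ rfl, p4]
  have l5 : s₅.arr aLeft = leftChild n p := by rw [ae _ rfl, d1]
  refine Runs.seq (runs_headCmd T hw' (by omega) n5 p5 l5).frame ?_
  rintro s₆ ⟨f1, vf, af⟩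
  have n6 : s₆.var vN = n := by rw [vf _ rfl, n5]
  have p6 : s₆.arr aPar = p := by rw [af _ rfl, p5]
  have l6 : s₆.arr aLeft = leftChild n p := by rw [af _ rfl, l5]
  refine Runs.seq (runs_nextCmd T hw' (by omega) n6 p6 l6 (af _ rfl) e1
    (by rw [af _ rfl, ae _ rfl, ad _ rfl, ac _ rfl, ab _ rfl, aa _ rfl, h0 _ (by omega)])).frame ?_
  rintro s₇ ⟨g1, vg, ag⟩
  have n7 : s₇.var vN = n := by rw [vg _ rfl, n6]
  have p7 : s₇.arr aPar = p := by rw [ag _ rfl, p6]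
  have l7 : s₇.arr aLeft = leftChild n p := by rw [ag _ rfl, l6]
  have low7 : s₇.arr aLow = s₅.arr aLow := by rw [ag _ rfl, af _ rfl]
  refine Runs.seq (runs_valueCmd hw' (by omega) n7 p7 low7 (ag _ rfl) g1).frame ?_
  rintro s₈ ⟨i1, vi, ai⟩
  have n8 : s₈.var vN = n := by rw [vi _ rfl, n7]
  have size8 : s₈.var vSize = s₁.var vSize := by
    rw [vi _ rfl, vg _ rfl, vf _ rfl, ve _ rfl, vd _ rfl, vc _ rfl, vb _ rfl]
  have pow8 : s₈.arr aPow = s₁.arr aPow := by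
    rw [ai _ rfl, ag _ rfl, af _ rfl, ae _ rfl, ad _ rfl, ac _ rfl, ab _ rfl]
  have log8 : s₈.arr aLog = s₂.arr aLog := by
    rw [ai _ rfl, ag _ rfl, af _ rfl, ae _ rfl, ad _ rfl, ac _ rfl]
  have bit8 : s₈.arr aBit = s₂.arr aBit := by
    rw [ai _ rfl, ag _ rfl, af _ rfl, ae _ rfl, ad _ rfl, ac _ rfl]
  have hsize : 1 ≤ s₁.var vSize := by
    by_contra hcon
    rw [show s₁.var vSize = 0 by omega, pow_zero] at a2
    omega
  refine Runs.seq (runs_maskCmd hw' (by omega) n8 size8 hsize a3 rfl (by rwa [pow8])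
    (by rwa [log8])).frame ?_
  rintro s₉ ⟨⟨j1, j2⟩, vj, aj⟩
  have tab9 : BlockTables n (s₁.var vSize) (s₈.arr aVal) s₉ := by
    refine ⟨hsize, a2, a3, by rw [vj _ rfl, size8], j1, aj _ rfl, ?_, ?_, ?_, j2⟩
    · rwa [aj _ rfl, pow8]
    · rwa [aj _ rfl, log8]
    · rwa [aj _ rfl, bit8]
  refine (runs_minCmd hw' (by omega) tab9).frame.mono le_rfl ?_
  rintro s' ⟨k1, vk, ak⟩
  have val : s'.arr aVal = s₈.arr aVal := by rw [ak _ rfl, aj _ rfl]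
  have head : s'.arr aHead = s₆.arr aHead := by
    rw [ak _ rfl, aj _ rfl, ai _ rfl, ag _ rfl]
  refine ⟨by rw [ak _ rfl, aj _ rfl, ai _ rfl, p7], by rw [ak _ rfl, aj _ rfl, ai _ rfl, l7],
    by rwa [head], ⟨_, e2, by rwa [head, val]⟩, s₁.var vSize, ?_, by rwa [val]⟩
  rw [val]
  exact tab9.congr (vk _ rfl) (vk _ rfl) (ak _ rfl) (ak _ rfl) (ak _ rfl) (ak _ rfl) (ak _ rfl)

/-- Finds the child of `vA` on the leftmost path to `vB` (and puts `0` into `vJ` if there is no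
such path). -/
def childCmd : Cmd :=
  .assign vI (.get aHead (.var vB)) ;;
  .branch ((Expr.get aPar (.var vI)).eq (.var vA))
    (.assign vJ (.var vI))
    (.branch (((Expr.get aHead (.var vA)).eq (.var vI)) * ((Expr.var vA).lt (.var vB)))
      (.assign vJ (.get aLeft (.var vA)))
      (.assign vJ 0))

/-- Computes the answer from the child in `vJ` and the head of the leftmost path of `vB` in `vI`. -/
def answerCmd : Cmd :=
  .branch (.var vJ)
    (.branch ((Expr.var vJ).eq (.var vB)) .nop
      (.assign vJ (.var vJ + 1) ;;
       rangeCmd ;;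
       .branch ((Expr.var vP).lt (.get aPar (.var vI))) (.assign vA 0) (.assign vA (.var vP))))
    (.assign vA 0)

/-- Answers a query. -/
def queryCmd : Cmd := childCmd ;; answerCmd

/-- `c` is the child of `a` on a leftmost path that ends in `b`. -/
def IsPathChild (p last : ℕ → ℕ) (a b c : ℕ) : Prop :=
  1 ≤ c ∧ c ≤ b ∧ last c = last b ∧ p c = a

theorem run_childCmd {w n a b : ℕ} {p last : ℕ → ℕ} (T : PreTree n p last)
    (hw : 100 * (n + 1) ≤ 2 ^ w) {s : State} (hp : s.arr aPar = p)
    (hl : s.arr aLeft = leftChild n p) (hh : PreTree.IsHead n last (s.arr aHead))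
    (hA : s.var vA = a) (hB : s.var vB = b) (ha : 1 ≤ a) (hb : 1 ≤ b) (hbn : b ≤ n) :
    ∃ c, childCmd.run w s = (s.setVar vI (s.arr aHead b)).setVar vJ c ∧
      (c = 0 ∧ (¬ ∃ c, IsPathChild p last a b c) ∨ IsPathChild p last a b c) := by
  obtain ⟨k1, k2, k3, k4⟩ := hh b hb hbn
  by_cases h1 : p (s.arr aHead b) = a
  · refine ⟨s.arr aHead b, ?_, Or.inr ⟨k1, k2, k3, h1⟩⟩
    simp [childCmd, Cmd.run, hp, hA, hB, h1]
  by_cases h2 : s.arr aHead a = s.arr aHead b ∧ a < b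
  · obtain ⟨h2, h3⟩ := h2
    refine ⟨leftChild n p a, ?_, Or.inr ?_⟩
    · simp (disch := omega) [childCmd, Cmd.run, hp, hA, hB, h1, hl, h2, h3, mod_small]
    · have hlast := (PreTree.head_eq_iff hh ha h3.le hbn).1 h2
      obtain ⟨j1, j2⟩ := T.leftChild_of_lt ha h3 hbn hlast
      exact ⟨by omega, j2, (T.last_leftChild j1).trans hlast, (PreTree.par_leftChild j1).2⟩
  · refine ⟨0, ?_, Or.inl ⟨rfl, ?_⟩⟩
    · have htest : ((if s.arr aHead a = s.arr aHead b then 1 else 0) *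
          if a < b then 1 else 0) = 0 := by
        rw [not_and_or] at h2
        rcases h2 with h | h <;> simp [h]
      simp (disch := omega) [childCmd, Cmd.run, hp, hA, hB, h1, htest]
    · rintro ⟨c, c1, c2, c3, c4⟩
      -- `c` is not the head, so `a` is on the same leftmost path
      have hc := k4 c c1 c2 c3
      have hne : s.arr aHead b ≠ c := by rintro rfl; exact h1 c4
      obtain ⟨j1, j2⟩ := T.par_of_lt k1 (by omega : _ < c) (by omega) (by omega)
      have := T.par_lt c c1 (by omega)
      rw [c4] at j1 j2
      exact h2 ⟨(PreTree.head_eq_iff hh ha (by omega) hbn).2 (by omega), by omega⟩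

theorem run_queryCmd {w n a b : ℕ} {p last : ℕ → ℕ} {E : ℕ → ℕ → Prop} (T : PreTree n p last)
    (hw : 100 * (n + 1) ≤ 2 ^ w) {s : State} (hs : Prepared n p last E s)
    (hA : s.var vA = a) (hB : s.var vB = b) (ha : 1 ≤ a) (hb : 1 ≤ b) (hbn : b ≤ n) :
    ((¬ ∃ c, IsPathChild p last a b c) ∧ (queryCmd.run w s).var vA = 0) ∨
      ∃ c, IsPathChild p last a b c ∧
        (∀ u, 1 ≤ u → u ≤ c → last u = last b → Valid E p u b →
          p u ≤ (queryCmd.run w s).var vA) ∧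
        ((queryCmd.run w s).var vA ≠ 0 → ∃ u, 1 ≤ u ∧ u ≤ c ∧ last u = last b ∧ Valid E p u b ∧
          (queryCmd.run w s).var vA = p u) := by
  obtain ⟨hp, hl, hh, ⟨low, hlow, hval⟩, size, htab, hsparse⟩ := hs
  obtain ⟨c, hrun, hc⟩ := run_childCmd T hw hp hl hh hA hB ha hb hbn
  have hq : queryCmd.run w s =
      answerCmd.run w ((s.setVar vI (s.arr aHead b)).setVar vJ c) := by
    rw [← hrun]
    rfl
  rw [hq]
  rcases hc with ⟨rfl, hc⟩ | hc
  · left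
    exact ⟨hc, by simp [answerCmd, Cmd.run]⟩
  right
  refine ⟨c, hc, ?_⟩
  obtain ⟨c1, c2, c3, c4⟩ := hc
  have hc0 : c ≠ 0 := by omega
  by_cases hcb : c = b
  · -- the path from `a` to its child `b` is stable
    have hans : (answerCmd.run w ((s.setVar vI (s.arr aHead b)).setVar vJ c)).var vA = a := by
      simp [answerCmd, Cmd.run, hcb, hB, hA, show b ≠ 0 by omega]
    rw [hans]
    subst hcb
    refine ⟨fun u u1 u2 u3 u4 => ?_, fun _ => ⟨c, c1, le_rfl, rfl, Valid.refl E p c, c4.symm⟩⟩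
    rw [← c4]
    exact T.par_mono u1 u2 hbn u3
  · obtain ⟨s₁, hs₁⟩ : ∃ s₁, s₁ = ((s.setVar vI (s.arr aHead b)).setVar vJ c).setVar vJ (c + 1) :=
      ⟨_, rfl⟩
    have t₁ : BlockTables n size (s.arr aVal) s₁ := by
      rw [hs₁]
      exact htab.congr rfl rfl rfl rfl rfl rfl rfl
    obtain ⟨r1, r2⟩ := run_rangeCmd (i := c + 1) (j := b) hw t₁
      (by rw [hs₁]; exact hsparse) (by rw [hs₁]; rfl) (by rw [hs₁]; exact hB) (by omega) hbn
    obtain ⟨m, hm⟩ : ∃ m, m = (rangeCmd.run w s₁).var vP := ⟨_, rfl⟩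
    have hpar : (rangeCmd.run w s₁).arr aPar = p := by
      obtain ⟨t, -, h⟩ := rangeCmd.exec_run w rfl s₁
      rw [h.arr_eq rfl, hs₁]
      exact hp
    rw [← hm] at r1
    have hI : s₁.var vI = s.arr aHead b := by rw [hs₁]; rfl
    rw [hI] at r2
    have hans : (answerCmd.run w ((s.setVar vI (s.arr aHead b)).setVar vJ c)).var vA =
        if m < p (s.arr aHead b) then 0 else m := by
      by_cases hlt : m < p (s.arr aHead b) <;>
      simp (disch := omega) [answerCmd, Cmd.run, hB, hc0, hcb, mod_small, ← hs₁, r2, hpar, ← hm, hlt]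
    rw [hans]
    obtain ⟨f1, f2⟩ := T.rangeMin_spec hlow hh hval c1 (by omega) hbn c3 r1
    by_cases hlt : m < p (s.arr aHead b)
    · rw [if_pos hlt]
      refine ⟨fun u u1 u2 u3 u4 => ?_, fun h => absurd rfl h⟩
      have := (f1 u u1 u2 u3 u4).2
      omega
    · rw [if_neg hlt]
      exact ⟨fun u u1 u2 u3 u4 => (f1 u u1 u2 u3 u4).1, fun _ => f2 (not_lt.1 hlt)⟩

theorem answers_queryCmd {V : Type u} [Fintype V] {G T : SimpleGraph V} {r : V} {num : V → ℕ}
    {m : ℕ} {e : Fin m → V × V} {w c : ℕ} (hN : IsNormalSpanningTree G T r)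
    (hc : IsCompatible G T r num) (he : IsEdgeList G e)
    (hw : 100 * (Fintype.card V + 1) ≤ 2 ^ w) (hcost : queryCmd.time ≤ c)
    (qs : List (V × V)) {s : State}
    (hs : Prepared (Fintype.card V) (parentNum T r num) (lastNum T r num)
      (inputRel T r num e) s) :
    Answers w queryCmd c num (stab G T r num) qs s := by
  induction qs generalizing s with
  | nil => trivial
  | cons q qs ih =>
    obtain ⟨a, b⟩ := q
    have P := hc.preTree hN.isTree
    have ha := hc.num_mem a
    have hb := hc.num_mem b
    obtain ⟨s₁, hs₁⟩ : ∃ s₁, s₁ = (s.setVar vA (num a)).setVar vB (num b) := ⟨_, rfl⟩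
    have p₁ : Prepared (Fintype.card V) (parentNum T r num) (lastNum T r num)
        (inputRel T r num e) s₁ := by
      rw [hs₁]
      exact hs.congr (fun _ => rfl) rfl rfl
    obtain ⟨t, ht, hexec⟩ := queryCmd.exec_run w rfl s₁
    refine ⟨t, queryCmd.run w s₁, hs₁ ▸ hexec, ht.trans hcost, ?_,
      ih (p₁.congr (fun k => hexec.arr_eq ?_) (hexec.var_eq rfl) (hexec.var_eq rfl))⟩
    · rcases run_queryCmd P hw p₁ (by rw [hs₁]; rfl) (by rw [hs₁]; rfl) ha.1 hb.1 hb.2 with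
        ⟨h1, h2⟩ | ⟨x, ⟨x1, x2, x3, x4⟩, h2, h3⟩
      · rw [h2, stab_eq_zero hN hc a b h1]
      · exact (stab_eq_of_isGreatest hN hc he a b x1 x2 x3 x4 h2 h3).symm
    · simp [queryCmd, childCmd, answerCmd, rangeCmd, Cmd.keepsArr]

end StabQuery

open StabQuery
theorem mainTheorem3 :
    ∃ (pre query : StabQuery.Cmd) (c : ℕ),
      ∀ (V : Type u) [Fintype V] (G T : SimpleGraph V) (r : V) (num : V → ℕ)
        (m : ℕ) (e : Fin m → V × V) (w : ℕ),
        IsNormalSpanningTree G T r →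
        IsCompatible G T r num →
        IsEdgeList G e →
        (Fintype.card V + m + 1) ^ c ≤ 2 ^ w →
        ∃ (t : ℕ) (s : StabQuery.State),
          Exec w pre (inputState T r num e) t s ∧
          t ≤ c * (Fintype.card V + m) ∧
          ∀ qs : List (V × V), Answers w query c num (stab G T r num) qs s := by
  refine ⟨preCmd, queryCmd, 20 * preCmd.time + queryCmd.time + 20, ?_⟩
  intro V _ G T r num m e w hN hc he hw
  have hn : 1 ≤ Fintype.card V := Fintype.card_pos_iff.2 ⟨r⟩
  have hw' : 100 * (Fintype.card V + m + 1) ≤ 2 ^ w := by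
    refine le_trans ?_ ((Nat.pow_le_pow_right (by omega : 0 < Fintype.card V + m + 1)
      (by omega : 20 ≤ 20 * preCmd.time + queryCmd.time + 20)).trans hw)
    rw [pow_succ]
    refine Nat.mul_le_mul_right _ ?_
    calc 100 ≤ 2 ^ 19 := by norm_num
      _ ≤ _ := Nat.pow_le_pow_left (by omega) 19
  obtain ⟨t, s, h1, h2, h3⟩ := runs_preCmd (hc.preTree hN.isTree) hn hw'
    (s := inputState T r num e) rfl rfl (by funext i; simp [inputState])
    (fun k hk => by
      funext i
      simp [inputState, show k ≠ 0 by omega, show k ≠ 1 by omega, show k ≠ 2 by omega])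
  refine ⟨t, s, h1, h2.trans ?_, fun qs =>
    answers_queryCmd hN hc he (by omega) (by omega) qs h3⟩
  calc 20 * (Fintype.card V + m) * preCmd.time
      = 20 * preCmd.time * (Fintype.card V + m) := by ring
    _ ≤ _ := Nat.mul_le_mul_right _ (by omega)
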